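/- **Theorem 1.2.** Let $1\le p<\infty$ and let $({\rm X},{\sf d},\mathfrak m)$ be a metric measure space: $({\rm X},{\sf d})$ is a separable metric space, not necessarily complete, and $\mathfrak m$ is a non-trivial Radon (outer) measure on ${\rm X}$ that is finite on bounded sets. $\mathcal L^p({\rm X})$ denotes the $p$-integrable functions $u\colon{\rm X}\to\mathbb R$, $L^p({\rm X})$ its quotient by $\mathfrak m$-a.e. equality, and ${\rm Lip}({\rm X})$ the Lipschitz functions. For $\varepsilon>0$ an $\varepsilon$-chain is a finite sequence ${\sf c}=\{q_i\}_{i=0}^N$ in ${\rm X}$ with ${\sf d}(q_i,q_{i+1})\le\varepsilon$ for all $i<N$, and $\int_{\sf c}g:=\sum_{i=0}^{N-1}\frac{g(q_i)+g(q_{i+1})}2\,{\sf d}(q_i,q_{i+1})$ for $g\colon{\rm X}\to[0,+\infty]$ (with $\infty\cdot 0=0$). A Borel function $g\colon{\rm X}\to[0,+\infty]$ is an $\varepsilon$-upper gradient of $u\colon{\rm X}\to\mathbb R$, written $g\in{\rm UG}^\varepsilon(u)$, if $|u(q_N)-u(q_0)|\le\int_{\sf c}g$ for every $\varepsilon$-chain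 ${\sf c}$. The local Lipschitz constant is ${\rm lip}\,u(x):=\lim_{\varepsilon\to0}\sup_{y\in B_\varepsilon(x)\setminus\{x\}}\frac{|u(y)-u(x)|}{{\sf d}(y,x)}$ (equal to $0$ at isolated points). For $u\in\mathcal L^p({\rm X})$ put, with $\inf\emptyset=+\infty$, $$F_{\rm Chain}(u):=\lim_{\varepsilon\to0}\inf\{\|g\|_{L^p({\rm X})}: g\in{\rm UG}^\varepsilon(u)\},$$ $$F_{\rm Chain,Lip}(u):=\lim_{\varepsilon\to0}\inf\{\|g\|_{L^p({\rm X})}: g\in{\rm UG}^\varepsilon(u)\cap{\rm Lip}({\rm X})\},\qquad F_{\rm AGS}(u):=\|{\rm lip}\,u\|_{L^p({\rm X})}$$ if $u\in{\rm Lip}({\rm X})$, and $F_{\rm Chain,Lip}(u):=F_{\rm AGS}(u):=+\infty$ if $u\notin{\rm Lip}({\rm X})$. For each of these functionals $F$ and $u\in L^p({\rm X})$ let $$\tilde F(u):=\inf\Big\{\liminf_{j\to\infty}F(u_j): u_j\in\mathcal L^p({\rm X}),\ u_j\to u\text{ in }L^p({\rm X})\Big\}$$ be its relaxation, let $H^{1,p}_F({\rm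 X}):=\{u\in L^p({\rm X}):\tilde F(u)<+\infty\}$, and let $\|u\|_{H^{1,p}_F({\rm X})}:=\big(\|u\|_{L^p({\rm X})}^p+\tilde F(u)^p\big)^{1/p}\in[0,+\infty]$. Write $H^{1,p}_{\rm Chain}({\rm X})$, $H^{1,p}_{\rm Chain,Lip}({\rm X})$ and $H^{1,p}_{\rm AGS}({\rm X})$ for the resulting spaces. Then $$H^{1,p}_{\rm Chain,Lip}({\rm X})=H^{1,p}_{\rm Chain}({\rm X})=H^{1,p}_{\rm AGS}({\rm X})$$ and, for every $u\in L^p({\rm X})$, $$\|u\|_{H^{1,p}_{\rm Chain,Lip}({\rm X})}=\|u\|_{H^{1,p}_{\rm Chain}({\rm X})}=\|u\|_{H^{1,p}_{\rm AGS}({\rm X})}.$$ -/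

import Mathlib

open MeasureTheory Filter Topology
open scoped ENNReal NNReal

namespace ChainSobolev

noncomputable section

/-- `u` belongs to `Lip(X)`: it is Lipschitz for some constant. -/
def IsLip {X : Type*} [MetricSpace X] (u : X → ℝ) : Prop :=
  ∃ K : ℝ≥0, LipschitzWith K u

/-- The slope of `u` at size `ε`: the supremum of `|u y - u x| / d(y, x)` over the points
`y ≠ x` of the ball `B_ε(x)` (it is `0` when there is no such point). -/
def slope {X : Type*} [MetricSpace X] (u : X → ℝ) (ε : ℝ) (x : X) : ℝ≥0∞ :=
  ⨆ y ∈ Metric.ball x ε \ {x}, ENNReal.ofReal (|u y - u x| / dist y x)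

/-- The local Lipschitz constant `lip u (x) = inf_{ε > 0} slope_ε u (x)`. -/
def lip {X : Type*} [MetricSpace X] (u : X → ℝ) (x : X) : ℝ≥0∞ :=
  ⨅ ε ∈ Set.Ioi (0 : ℝ), slope u ε x

/-- A finite sequence of points `q 0, …, q N` is an `ε`-chain if consecutive points have distance
at most `ε`. -/
def IsEpsChain {X : Type*} [MetricSpace X] (ε : ℝ) {N : ℕ} (q : Fin (N + 1) → X) : Prop :=
  ∀ i : Fin N, dist (q i.castSucc) (q i.succ) ≤ ε

/-- The integral of `g` along the chain `q 0, …, q N`: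
`∑_{i < N} (g (q i) + g (q (i + 1))) / 2 * d(q i, q (i + 1))`, with `∞ * 0 = 0`. -/
def chainIntegral {X : Type*} [MetricSpace X] (g : X → ℝ≥0∞) {N : ℕ} (q : Fin (N + 1) → X) :
    ℝ≥0∞ :=
  ∑ i : Fin N, (g (q i.castSucc) + g (q i.succ)) / 2 * edist (q i.castSucc) (q i.succ)

/-- The Borel functions `g : X → [0, ∞]` that are `ε`-upper gradients of `u`. -/
def UG {X : Type*} [MetricSpace X] [MeasurableSpace X] (ε : ℝ) (u : X → ℝ) :
    Set (X → ℝ≥0∞) :=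
  {g | Measurable g ∧ ∀ (N : ℕ) (q : Fin (N + 1) → X), IsEpsChain ε q →
    ENNReal.ofReal |u (q (Fin.last N)) - u (q 0)| ≤ chainIntegral g q}

/-- The `ε`-upper gradients of `u` that are (finite and) Lipschitz. -/
def LUG {X : Type*} [MetricSpace X] [MeasurableSpace X] (ε : ℝ) (u : X → ℝ) :
    Set (X → ℝ≥0∞) :=
  UG ε u ∩ {g | ∃ (f : X → ℝ≥0) (K : ℝ≥0), LipschitzWith K f ∧ g = fun x => (f x : ℝ≥0∞)}

/-- The infimum of the `L^p` norms of the `ε`-upper gradients of `u` (`∞` if there are none). -/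
def infUG {X : Type*} [MetricSpace X] [MeasurableSpace X] (p : ℝ≥0∞) (μ : Measure X)
    (u : X → ℝ) (ε : ℝ) : ℝ≥0∞ :=
  ⨅ g ∈ UG ε u, eLpNorm g p μ

/-- The infimum of the `L^p` norms of the Lipschitz `ε`-upper gradients of `u`. -/
def infLUG {X : Type*} [MetricSpace X] [MeasurableSpace X] (p : ℝ≥0∞) (μ : Measure X)
    (u : X → ℝ) (ε : ℝ) : ℝ≥0∞ :=
  ⨅ g ∈ LUG ε u, eLpNorm g p μ

/-- The functional `F_Chain(u) = lim_{ε → 0} inf {‖g‖_p : g ∈ UG ε u}`. The limit is an infimum,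
see `tendsto_infUG`. -/
def FChain {X : Type*} [MetricSpace X] [MeasurableSpace X] (p : ℝ≥0∞) (μ : Measure X)
    (u : X → ℝ) : ℝ≥0∞ :=
  ⨅ ε ∈ Set.Ioi (0 : ℝ), infUG p μ u ε

open Classical in
/-- The functional `F_{Chain,Lip}(u) = lim_{ε → 0} inf {‖g‖_p : g ∈ LUG ε u}` for Lipschitz `u`,
and `∞` otherwise. The limit is an infimum, see `tendsto_infLUG`. -/
def FChainLip {X : Type*} [MetricSpace X] [MeasurableSpace X] (p : ℝ≥0∞) (μ : Measure X)
    (u : X → ℝ) : ℝ≥0∞ :=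
  if IsLip u then ⨅ ε ∈ Set.Ioi (0 : ℝ), infLUG p μ u ε else ∞

open Classical in
/-- The Ambrosio–Gigli–Savaré functional: `‖lip u‖_p` for Lipschitz `u`, and `∞` otherwise. -/
def FAGS {X : Type*} [MetricSpace X] [MeasurableSpace X] (p : ℝ≥0∞) (μ : Measure X)
    (u : X → ℝ) : ℝ≥0∞ :=
  if IsLip u then eLpNorm (lip u) p μ else ∞

/-- The relaxation of a functional `F` defined on the `p`-integrable functions (not on classes):
the infimum of `liminf_j F (v j)` over the sequences of `p`-integrable functions `v j` that converge
to `u` in `L^p`. -/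
def relaxation {X : Type*} [MeasurableSpace X] (p : ℝ≥0∞) (μ : Measure X)
    (F : (X → ℝ) → ℝ≥0∞) (u : Lp ℝ p μ) : ℝ≥0∞ :=
  sInf {a | ∃ v : ℕ → X → ℝ, (∀ j, MemLp (v j) p μ) ∧
    Tendsto (fun j => eLpNorm (v j - ⇑u) p μ) atTop (𝓝 0) ∧
    a = liminf (fun j => F (v j)) atTop}

/-- The space of the `u ∈ L^p` whose relaxed energy is finite. -/
def space {X : Type*} [MeasurableSpace X] (p : ℝ≥0∞) (μ : Measure X)
    (F : (X → ℝ) → ℝ≥0∞) : Set (Lp ℝ p μ) :=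
  {u | relaxation p μ F u < ∞}

/-- The norm `(‖u‖_p ^ p + (relaxed energy of u) ^ p) ^ (1 / p)`, with value `∞` outside of
the space. -/
def spaceNorm {X : Type*} [MeasurableSpace X] (p : ℝ≥0∞) (μ : Measure X)
    (F : (X → ℝ) → ℝ≥0∞) (u : Lp ℝ p μ) : ℝ≥0∞ :=
  (eLpNorm u p μ ^ p.toReal + relaxation p μ F u ^ p.toReal) ^ (1 / p.toReal)

/-- The chain Sobolev space `H^{1,p}_Chain(X)`. -/
def HChain {X : Type*} [MetricSpace X] [MeasurableSpace X] (p : ℝ≥0∞) (μ : Measure X) :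
    Set (Lp ℝ p μ) :=
  space p μ (FChain p μ)

/-- The norm of `H^{1,p}_Chain(X)`. -/
def normHChain {X : Type*} [MetricSpace X] [MeasurableSpace X] (p : ℝ≥0∞) (μ : Measure X)
    (u : Lp ℝ p μ) : ℝ≥0∞ :=
  spaceNorm p μ (FChain p μ) u

/-- The Lipschitz chain Sobolev space `H^{1,p}_{Chain,Lip}(X)`. -/
def HChainLip {X : Type*} [MetricSpace X] [MeasurableSpace X] (p : ℝ≥0∞) (μ : Measure X) :
    Set (Lp ℝ p μ) :=
  space p μ (FChainLip p μ)

/-- The norm of `H^{1,p}_{Chain,Lip}(X)`. -/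
def normHChainLip {X : Type*} [MetricSpace X] [MeasurableSpace X] (p : ℝ≥0∞) (μ : Measure X)
    (u : Lp ℝ p μ) : ℝ≥0∞ :=
  spaceNorm p μ (FChainLip p μ) u

/-- The Ambrosio–Gigli–Savaré Sobolev space `H^{1,p}_AGS(X)`. -/
def HAGS {X : Type*} [MetricSpace X] [MeasurableSpace X] (p : ℝ≥0∞) (μ : Measure X) :
    Set (Lp ℝ p μ) :=
  space p μ (FAGS p μ)

/-- The norm of `H^{1,p}_AGS(X)`. -/
def normHAGS {X : Type*} [MetricSpace X] [MeasurableSpace X] (p : ℝ≥0∞) (μ : Measure X)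
    (u : Lp ℝ p μ) : ℝ≥0∞ :=
  spaceNorm p μ (FAGS p μ) u

/-- An `ε`-upper gradient is an `ε'`-upper gradient for `ε' ≤ ε`. -/
theorem UG_anti {X : Type*} [MetricSpace X] [MeasurableSpace X] (u : X → ℝ) {ε' ε : ℝ}
    (h : ε' ≤ ε) : UG ε u ⊆ UG ε' u :=
  fun _ hg => ⟨hg.1, fun N q hq => hg.2 N q fun i => (hq i).trans h⟩

/-- `lip u` is the limit of the slopes. -/
theorem tendsto_slope {X : Type*} [MetricSpace X] (u : X → ℝ) (x : X) :
    Tendsto (fun ε => slope u ε x) (𝓝[>] 0) (𝓝 (lip u x)) := by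
  have hm : Monotone fun ε => slope u ε x := fun a b hab =>
    biSup_mono fun y hy => ⟨Metric.ball_subset_ball hab hy.1, hy.2⟩
  simpa only [lip, sInf_image] using hm.tendsto_nhdsGT 0

/-- The infimum in `FChain` is the limit for `ε → 0`. -/
theorem tendsto_infUG {X : Type*} [MetricSpace X] [MeasurableSpace X] (p : ℝ≥0∞)
    (μ : Measure X) (u : X → ℝ) :
    Tendsto (infUG p μ u) (𝓝[>] 0) (𝓝 (FChain p μ u)) := by
  have hm : Monotone (infUG p μ u) := fun a b hab => biInf_mono (UG_anti u hab)
  simpa only [FChain, sInf_image] using hm.tendsto_nhdsGT 0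

/-- The infimum in `FChainLip` is the limit for `ε → 0`. -/
theorem tendsto_infLUG {X : Type*} [MetricSpace X] [MeasurableSpace X] (p : ℝ≥0∞)
    (μ : Measure X) (u : X → ℝ) (hu : IsLip u) :
    Tendsto (infLUG p μ u) (𝓝[>] 0) (𝓝 (FChainLip p μ u)) := by
  have hm : Monotone (infLUG p μ u) := fun a b hab =>
    biInf_mono fun g hg => ⟨UG_anti u hab hg.1, hg.2⟩
  simpa only [FChainLip, if_pos hu, sInf_image] using hm.tendsto_nhdsGT 0

end

end ChainSobolev

/-!
The point of departure is that the `ε`-upper gradient inequality along chains is equivalent to its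
two-point form `|u y - u x| ≤ (g x + g y) / 2 * d(x, y)` for `d(x, y) ≤ ε` (`IsPairUG`), by
telescoping. Hence the functions of finite chain energy are of Hajłasz type at a fixed scale, and
Lipschitz truncation is available without completeness, doubling or a Poincaré inequality.

`FChainLip` is the largest of the three energies: it dominates `FChain` trivially, and `FAGS` since
a continuous upper gradient bounds the local Lipschitz constant pointwise. It remains to approximate
a function `u` in `L^p` by Lipschitz functions whose `FChainLip` is almost at most the norm of a
given upper gradient `g` (`exists_lipschitz_approx`). This suffices both for `FChain` and for
`FAGS`; for the latter `g` is a slope of `u` at a small scale, and slopes converge to `lip u` in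
`L^p` on bounded sets.

After multiplication by a cutoff function, `u` and `g` have bounded support
(`IsPairUG.mul_cutoff`). Let `W = max (g, 2 |u| / ε)`, let `G` be a Lipschitz function close to `g`
in `L^p`, and let `A` be the set where `W ≤ M` and `g ≤ G + η`. On `A` the function `u` is
`M`-Lipschitz, and at small scales its oscillation is bounded by `G + η`. It has an extension to the
whole space whose Lipschitz constant is a multiple of `M`, and which has near `A` the upper gradient
`G` up to a multiple of `η` (`exists_lipschitz_extension`). The extension therefore has a Lipschitz
upper gradient that differs from `g` by little on `A` and is at most a multiple of `M` outside. By
Chebyshev's inequality `M` times the indicator function of the complement of `A` is small in `L^p`,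
if `M` is chosen large first, then `η` small, and then `G` close to `g`
(`exists_lipschitz_approx_of_bounded_support`).
-/

open MeasureTheory Filter Topology
open scoped ENNReal NNReal

namespace ChainSobolev

/-! ### Upper gradients as two-point inequalities -/

/-- The two-point form of the `ε`-upper gradient inequality. Since chains are telescoped by the
triangle inequality, it is equivalent to the inequality along all `ε`-chains. -/
def IsPairUG {X : Type*} [MetricSpace X] (ε : ℝ) (u : X → ℝ) (g : X → ℝ≥0∞) : Prop :=
  ∀ x y, dist x y ≤ ε → ENNReal.ofReal |u y - u x| ≤ (g x + g y) / 2 * edist x y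

theorem IsPairUG.mono {X : Type*} [MetricSpace X] {ε' ε : ℝ} {u : X → ℝ} {g : X → ℝ≥0∞}
    (h : IsPairUG ε u g) (hε : ε' ≤ ε) : IsPairUG ε' u g :=
  fun x y hxy => h x y (hxy.trans hε)

theorem IsPairUG.of_mem_UG {X : Type*} [MetricSpace X] [MeasurableSpace X] {ε : ℝ} {u : X → ℝ}
    {g : X → ℝ≥0∞} (hg : g ∈ UG ε u) : IsPairUG ε u g := by
  intro x y hxy
  have := hg.2 1 ![x, y] (by intro i; fin_cases i; simpa using hxy)
  simpa [chainIntegral] using this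

theorem IsPairUG.mem_UG {X : Type*} [MetricSpace X] [MeasurableSpace X] {ε : ℝ} {u : X → ℝ}
    {g : X → ℝ≥0∞} (h : IsPairUG ε u g) (hg : Measurable g) : g ∈ UG ε u := by
  refine ⟨hg, fun N => ?_⟩
  induction N with
  | zero => intro q _; simp
  | succ N ih =>
    intro q hq
    have h1 := ih (fun i => q i.castSucc) fun i => hq i.castSucc
    have h2 := h _ _ (hq (Fin.last N))
    rw [chainIntegral, Fin.sum_univ_castSucc]
    calc ENNReal.ofReal |u (q (Fin.last (N + 1))) - u (q 0)|
        ≤ ENNReal.ofReal (|u (q (Fin.last N).castSucc) - u (q 0)|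
            + |u (q (Fin.last (N + 1))) - u (q (Fin.last N).castSucc)|) := by
          gcongr
          exact (abs_sub_le _ (u (q (Fin.last N).castSucc)) _).trans_eq (add_comm _ _)
      _ ≤ _ := ENNReal.ofReal_add_le
      _ ≤ _ := add_le_add h1 h2

/-! ### Lipschitz extension with control of the local oscillation -/

/-- A pointwise infimum of a family of `K`-Lipschitz functions that is bounded below everywhere
is `K`-Lipschitz. -/
theorem lipschitzWith_ciInf {X ι : Type*} [PseudoMetricSpace X] [Nonempty ι] {K : ℝ≥0}
    {φ : ι → X → ℝ} (hφ : ∀ i, LipschitzWith K (φ i))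
    (hb : ∀ x, BddBelow (Set.range fun i => φ i x)) : LipschitzWith K fun x => ⨅ i, φ i x := by
  refine LipschitzWith.of_le_add_mul K fun x y => ?_
  rw [← sub_le_iff_le_add]
  refine le_ciInf fun i => ?_
  rw [sub_le_iff_le_add]
  exact (ciInf_le (hb x) i).trans ((hφ i).le_add_mul x y)

/-- Extension of a Lipschitz function from a set `A` that preserves the local Lipschitz bound.
If the oscillation of `u` on `A` at scale `ε` is bounded by a Lipschitz function `G ≤ M`, then `u`
has a Lipschitz extension `f`, with constant controlled by `M` alone, whose oscillation near `A`
is bounded by `G + 3 η`. -/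
theorem exists_lipschitz_extension {X : Type*} [MetricSpace X] {A : Set X} (hA : A.Nonempty)
    {u G : X → ℝ} {M η ε : ℝ} {Λ : ℝ≥0} (hε : 0 < ε) (hη : 0 < η) (hηM : η ≤ M)
    (hG : LipschitzWith Λ G) (hG0 : ∀ x, 0 ≤ G x) (hGM : ∀ x, G x ≤ M)
    (hu : ∀ x ∈ A, ∀ y ∈ A, |u x - u y| ≤ M * dist x y)
    (hpair : ∀ x ∈ A, ∀ y ∈ A, dist x y ≤ ε → |u x - u y| ≤ (G x + G y) / 2 * dist x y) :
    ∃ f : X → ℝ, LipschitzWith (4 * M).toNNReal f ∧ Set.EqOn f u A ∧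
      ∃ δ > 0, ∀ x x', dist x x' ≤ δ → Metric.infDist x A < δ →
        f x' - f x ≤ (min (G x) (G x') + 3 * η) * dist x x' := by
  have hM : 0 < M := hη.trans_le hηM
  have : Nonempty A := hA.to_subtype
  obtain ⟨r, hr0, hrε, hrΛ⟩ : ∃ r > 0, r ≤ ε ∧ Λ * r ≤ η := by
    refine ⟨min ε (η / (Λ + 1)), by positivity, min_le_left _ _, ?_⟩
    calc Λ * min ε (η / (Λ + 1)) ≤ (Λ + 1) * (η / (Λ + 1)) := by
          gcongr
          · simp
          · exact min_le_right _ _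
      _ = η := by field_simp
  have hGd : ∀ x y, G x ≤ G y + Λ * dist x y := fun x y => hG.le_add_mul x y
  -- The cost `m a t` has slope `a + 2 η` for `t ≤ r / 2` and becomes steep afterwards, so that
  -- far away points of `A` never compete in the infimum defining `f`.
  set m : ℝ → ℝ → ℝ := fun a t => max ((a + 2 * η) * t) (4 * M * t - 2 * M * r) with hm
  have m_lip : ∀ a s t, 0 ≤ a → a ≤ M → m a s ≤ m a t + 4 * M * |s - t| := by
    intro a s t ha haM
    have hst := le_abs_self (s - t)
    have h0 := abs_nonneg (s - t)
    refine max_le ?_ ?_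
    · have := le_max_left ((a + 2 * η) * t) (4 * M * t - 2 * M * r)
      nlinarith [mul_le_mul_of_nonneg_left hst (by linarith : 0 ≤ a + 2 * η),
        mul_le_mul_of_nonneg_right (by linarith : a + 2 * η ≤ 4 * M) h0]
    · have := le_max_right ((a + 2 * η) * t) (4 * M * t - 2 * M * r)
      nlinarith
  have gap : ∀ x ∈ A, ∀ y ∈ A, u x + η * dist x y ≤ u y + m (G y) (dist x y) := by
    intro x hx y hy
    have hd : 0 ≤ dist x y := dist_nonneg
    rcases le_total (dist x y) r with h | h
    · have h1 := (abs_le.1 (hpair x hx y hy (h.trans hrε))).2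
      have h2 : G x ≤ G y + η :=
        (hGd x y).trans (by linarith [mul_le_mul_of_nonneg_left h Λ.coe_nonneg])
      have h3 := le_max_left ((G y + 2 * η) * dist x y) (4 * M * dist x y - 2 * M * r)
      simp only [hm]
      nlinarith [mul_le_mul_of_nonneg_right h2 hd]
    · have h1 := (abs_le.1 (hu x hx y hy)).2
      have h3 := le_max_right ((G y + 2 * η) * dist x y) (4 * M * dist x y - 2 * M * r)
      simp only [hm]
      nlinarith [mul_le_mul_of_nonneg_left h hM.le, mul_le_mul_of_nonneg_right hηM hd]
  set φ : A → X → ℝ := fun y x => u y + m (G y) (dist x y) with hφ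
  have φ_le : ∀ (y : A) x x', φ y x ≤ φ y x' + 4 * M * dist x x' := by
    intro y x x'
    have h1 := m_lip (G y) (dist x y) (dist x' y) (hG0 _) (hGM _)
    have h2 := mul_le_mul_of_nonneg_left (abs_dist_sub_le x x' (y : X))
      (by linarith : 0 ≤ 4 * M)
    simp only [hφ]; linarith
  have φ_lip : ∀ y, LipschitzWith (4 * M).toNNReal (φ y) := fun y =>
    LipschitzWith.of_le_add_mul _ fun x x' => by
      rw [Real.coe_toNNReal _ (by linarith)]; exact φ_le y x x'
  have bdd : ∀ x, BddBelow (Set.range fun y => φ y x) := by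
    intro x
    obtain ⟨z, hz⟩ := hA
    refine ⟨u z - 4 * M * dist z x, ?_⟩
    rintro _ ⟨y, rfl⟩
    have h1 := gap z hz y y.2
    have h2 := φ_le y z x
    have h3 : 0 ≤ η * dist z y := by positivity
    simp only [hφ] at h2 ⊢
    linarith
  set f : X → ℝ := fun x => ⨅ y, φ y x with hf
  have f_le : ∀ x (y : A), f x ≤ φ y x := fun x y => ciInf_le (bdd x) y
  have f_lip : LipschitzWith (4 * M).toNNReal f := lipschitzWith_ciInf φ_lip bdd
  have f_eq : Set.EqOn f u A := by
    intro x hx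
    refine le_antisymm ((f_le x ⟨x, hx⟩).trans ?_) (le_ciInf fun y => ?_)
    · have : 0 ≤ 2 * M * r := by positivity
      simp [hφ, hm, this]
    · have h3 : 0 ≤ η * dist x y := by positivity
      linarith [gap x hx y y.2]
  -- The choice of `δ` makes the gap `η (r / 4 - δ)` exceed the Lipschitz error `8 M δ`.
  obtain ⟨δ, hδ0, hδ, hδr⟩ : ∃ δ > 0, 8 * M * δ < η * (r / 4 - δ) ∧ δ ≤ r / 4 := by
    refine ⟨η * r / (8 * (η + 8 * M)), by positivity, ?_, ?_⟩
    · have h : η * r / (8 * (η + 8 * M)) * (η + 8 * M) = η * r / 8 := by field_simp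
      have : 0 < η * r := by positivity
      nlinarith
    · rw [div_le_iff₀ (by positivity)]
      nlinarith [mul_pos hη hr0, mul_pos hM hr0]
  refine ⟨f, f_lip, f_eq, δ, hδ0, fun x x' hxx' hx => ?_⟩
  obtain ⟨x₀, hx₀, hxx₀⟩ := (Metric.infDist_lt_iff hA).1 hx
  refine le_of_forall_pos_lt_add fun τ hτ => ?_
  have hfx : f x ≤ u x₀ + 4 * M * δ := by
    have h1 := (f_lip.le_add_mul x x₀)
    rw [Real.coe_toNNReal _ (by linarith), f_eq hx₀] at h1
    nlinarith
  set τ' := min τ (η * (r / 4 - δ) - 8 * M * δ)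
  have hτ' : 0 < τ' := lt_min hτ (by linarith)
  obtain ⟨y, hy⟩ := exists_lt_of_ciInf_lt (show (⨅ y, φ y x) < f x + τ' by simp [hf, hτ'])
  -- An almost minimizing `y` lies within `r / 4` of `x`.
  have hyx : dist x y < r / 4 := by
    by_contra! hfar
    have h1 := gap x₀ hx₀ y y.2
    have h2 := φ_le y x₀ x
    have h3 : r / 4 - δ ≤ dist x₀ y := by
      have := dist_triangle x x₀ y; linarith
    have h4 := mul_le_mul_of_nonneg_left h3 hη.le
    have h5 : 4 * M * dist x₀ x ≤ 4 * M * δ := by rw [dist_comm]; gcongr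
    have h6 : τ' ≤ η * (r / 4 - δ) - 8 * M * δ := min_le_right _ _
    simp only [hφ] at h2 hy
    linarith
  have hyx' : dist x' y ≤ r / 2 := by
    have := dist_triangle x' x y; rw [dist_comm x' x] at this; linarith
  have h1 := f_le x' y
  have h2 : m (G y) (dist x' y) = (G y + 2 * η) * dist x' y := by
    refine max_eq_left ?_
    have : 0 ≤ (G y + 2 * η) * dist x' y := mul_nonneg (by linarith [hG0 y]) dist_nonneg
    nlinarith
  have h3 : (G y + 2 * η) * dist x y ≤ m (G y) (dist x y) := le_max_left _ _
  have h4 : (G y + 2 * η) * dist x' y ≤ (G y + 2 * η) * (dist x x' + dist x y) := by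
    have := dist_triangle x' x y
    rw [dist_comm x' x] at this
    exact mul_le_mul_of_nonneg_left this (by linarith [hG0 y])
  have h5 : G y ≤ min (G x) (G x') + η := by
    rw [← min_add_add_right]
    refine le_min ((hGd y x).trans ?_) ((hGd y x').trans ?_)
    · have := mul_le_mul_of_nonneg_left (by linarith : dist x y ≤ r) Λ.coe_nonneg
      rw [dist_comm]; linarith
    · have := mul_le_mul_of_nonneg_left (by linarith : dist x' y ≤ r) Λ.coe_nonneg
      rw [dist_comm]; linarith
  have h6 := mul_le_mul_of_nonneg_right h5 (dist_nonneg (x := x) (y := x'))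
  have h7 : τ' ≤ τ := min_le_left _ _
  simp only [hφ] at h1 hy
  nlinarith

/-- The extension of `exists_lipschitz_extension` has a Lipschitz upper gradient at a small scale,
equal to `G + 3 η` on `A` and bounded by a multiple of `M` elsewhere. -/
theorem exists_lipschitz_extension_upperGradient {X : Type*} [MetricSpace X] {A : Set X}
    {u G : X → ℝ} {M η ε : ℝ} {Λ : ℝ≥0} (hε : 0 < ε) (hη : 0 < η) (hηM : η ≤ M)
    (hG : LipschitzWith Λ G) (hG0 : ∀ x, 0 ≤ G x) (hGM : ∀ x, G x ≤ M)
    (hu : ∀ x ∈ A, ∀ y ∈ A, |u x - u y| ≤ M * dist x y)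
    (hpair : ∀ x ∈ A, ∀ y ∈ A, dist x y ≤ ε → |u x - u y| ≤ (G x + G y) / 2 * dist x y) :
    ∃ f H : X → ℝ, (∃ K, LipschitzWith K f) ∧ (∃ K, LipschitzWith K H) ∧ Set.EqOn f u A ∧
      (∀ x, 0 ≤ H x) ∧ (∀ x ∈ A, H x = G x + 3 * η) ∧ (∀ x, H x ≤ G x + 3 * η + 4 * M) ∧
      ∃ δ > 0, ∀ x y, dist x y ≤ δ → |f y - f x| ≤ (H x + H y) / 2 * dist x y := by
  have hM : 0 < M := hη.trans_le hηM
  rcases A.eq_empty_or_nonempty with rfl | hA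
  · have hH := hG.add (LipschitzWith.const (3 * η))
    refine ⟨fun _ => 0, _, ⟨_, LipschitzWith.const 0⟩, ⟨_, hH⟩, Set.eqOn_empty _ _, fun x => ?_,
      by simp, fun x => by linarith, 1, one_pos, fun x y _ => ?_⟩
    · have := hG0 x
      positivity
    · have := hG0 x
      have := hG0 y
      simp only [sub_self, abs_zero]
      positivity
  obtain ⟨f, hf, hfu, δ, hδ, h⟩ :=
    exists_lipschitz_extension hA hε hη hηM hG hG0 hGM hu hpair
  have hmin : LipschitzWith (‖4 * M‖₊ * ‖2 / δ‖₊)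
      fun x => (4 * M) • min 1 ((2 / δ) • Metric.infDist x A) := by
    have h1 : LipschitzWith ‖2 / δ‖₊ fun x => (2 / δ) • Metric.infDist x A := by
      simpa [Function.comp_def] using (lipschitzWith_smul (2 / δ)).comp (Metric.lipschitz_infDist_pt A)
    simpa [Function.comp_def] using (lipschitzWith_smul (4 * M)).comp (h1.const_min 1)
  have hH := (hG.add (LipschitzWith.const (3 * η))).add hmin
  refine ⟨f, _, ⟨_, hf⟩, ⟨_, hH⟩, hfu, fun x => ?_, fun x hx => ?_, fun x => ?_, δ / 2,
    by positivity, fun x y hxy => ?_⟩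
  · have := Metric.infDist_nonneg (x := x) (s := A)
    have := hG0 x
    positivity
  · simp [Metric.infDist_zero_of_mem hx]
  · have : (4 * M) • min 1 ((2 / δ) • Metric.infDist x A) ≤ 4 * M :=
      mul_le_of_le_one_right (by positivity) (min_le_left _ _)
    linarith
  · have nn : ∀ z, 0 ≤ (4 * M) • min 1 ((2 / δ) • Metric.infDist z A) := fun z => by
      have := Metric.infDist_nonneg (x := z) (s := A)
      positivity
    have big : ∀ z, δ / 2 ≤ Metric.infDist z A →
        (4 * M) • min 1 ((2 / δ) • Metric.infDist z A) = 4 * M := fun z hz => by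
      rw [min_eq_left, smul_eq_mul, mul_one]
      rw [smul_eq_mul, div_mul_eq_mul_div, le_div_iff₀ hδ]
      linarith
    have hd : 0 ≤ dist x y := dist_nonneg
    by_cases hnear : Metric.infDist x A < δ ∧ Metric.infDist y A < δ
    · have h1 := h x y (by linarith) hnear.1
      have h2 := h y x (by rw [dist_comm]; linarith) hnear.2
      rw [dist_comm y x, min_comm] at h2
      have h3 : min (G x) (G y) + 3 * η ≤ (G x + G y) / 2 + 3 * η := by
        linarith [min_le_left (G x) (G y), min_le_right (G x) (G y)]
      have h4 := mul_le_mul_of_nonneg_right h3 hd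
      rw [abs_le]
      constructor <;> nlinarith [mul_nonneg (nn x) hd, mul_nonneg (nn y) hd]
    · have h1 := Metric.infDist_le_infDist_add_dist (s := A) (x := x) (y := y)
      have h2 := Metric.infDist_le_infDist_add_dist (s := A) (x := y) (y := x)
      rw [dist_comm y x] at h2
      have hx : δ / 2 ≤ Metric.infDist x A := by
        by_contra! hx; exact hnear ⟨by linarith, by linarith⟩
      have hy : δ / 2 ≤ Metric.infDist y A := by
        by_contra! hy; exact hnear ⟨by linarith, by linarith⟩
      have h3 := hf.dist_le_mul y x
      rw [Real.dist_eq, Real.coe_toNNReal _ (by linarith), dist_comm] at h3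
      simp only [big x hx, big y hy]
      nlinarith [mul_nonneg (hG0 x) hd, mul_nonneg (hG0 y) hd]

/-! ### Convergence and density in `L^p` -/

theorem tendsto_eLpNorm_of_dominated {α : Type*} [MeasurableSpace α] {μ : Measure α} {p : ℝ≥0∞}
    (hp0 : p ≠ 0) (hp : p ≠ ∞) {F : ℕ → α → ℝ≥0∞} {f W : α → ℝ≥0∞}
    (hF : ∀ n, AEMeasurable (F n) μ) (hW : eLpNorm W p μ ≠ ∞) (hle : ∀ n x, F n x ≤ W x)
    (hlim : ∀ᵐ x ∂μ, Tendsto (fun n => F n x) atTop (𝓝 (f x))) :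
    Tendsto (fun n => eLpNorm (F n) p μ) atTop (𝓝 (eLpNorm f p μ)) := by
  have hpos := ENNReal.toReal_pos hp0 hp
  simp only [eLpNorm_eq_lintegral_rpow_enorm_toReal hp0 hp, enorm_eq_self] at hW ⊢
  refine ((ENNReal.continuous_rpow_const (y := 1 / p.toReal)).tendsto _).comp ?_
  refine tendsto_lintegral_of_dominated_convergence' (fun x => W x ^ p.toReal)
    (fun n => (hF n).pow_const _) (fun n => Eventually.of_forall fun x => ?_) ?_ ?_
  · exact ENNReal.rpow_le_rpow (hle n x) hpos.le
  · intro h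
    rw [h, ENNReal.top_rpow_of_pos (by positivity)] at hW
    exact hW rfl
  · filter_upwards [hlim] with x hx
    exact ((ENNReal.continuous_rpow_const (y := p.toReal)).tendsto _).comp hx

theorem ae_lt_top_of_eLpNorm_ne_top {α : Type*} [MeasurableSpace α] {μ : Measure α} {p : ℝ≥0∞}
    (hp0 : p ≠ 0) (hp : p ≠ ∞) {W : α → ℝ≥0∞} (hW : AEMeasurable W μ)
    (hWn : eLpNorm W p μ ≠ ∞) : ∀ᵐ x ∂μ, W x < ∞ := by
  have hpos := ENNReal.toReal_pos hp0 hp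
  have h := lintegral_rpow_enorm_lt_top_of_eLpNorm_lt_top hp0 hp hWn.lt_top
  simp only [enorm_eq_self] at h
  filter_upwards [ae_lt_top' (hW.pow_const _) h.ne] with x hx
  by_contra! hc
  rw [top_le_iff.1 hc, ENNReal.top_rpow_of_pos hpos] at hx
  exact hx.ne rfl

theorem eLpNorm_const_mul_ennreal {α : Type*} [MeasurableSpace α] {μ : Measure α} {p : ℝ≥0∞}
    (hp0 : p ≠ 0) (hp : p ≠ ∞) {c : ℝ≥0∞} (hc : c ≠ ∞) (f : α → ℝ≥0∞) :
    eLpNorm (fun x => c * f x) p μ = c * eLpNorm f p μ := by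
  have hpos := ENNReal.toReal_pos hp0 hp
  simp only [eLpNorm_eq_lintegral_rpow_enorm_toReal hp0 hp, enorm_eq_self,
    ENNReal.mul_rpow_of_nonneg _ _ hpos.le]
  rw [lintegral_const_mul' _ _ (ENNReal.rpow_ne_top_of_nonneg hpos.le hc),
    ENNReal.mul_rpow_of_nonneg _ _ (by positivity), ← ENNReal.rpow_mul,
    mul_one_div_cancel hpos.ne', ENNReal.rpow_one]

/-- On a finite measure, nonnegative Lipschitz functions are dense in the nonnegative functions
of `L^p`: a continuous approximation `c` is the increasing limit of its Lipschitz envelopes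
`x ↦ inf_y (c y + n d(x, y))`. -/
theorem exists_lipschitz_eLpNorm_sub_le {X : Type*} [MetricSpace X]
    [TopologicalSpace.SeparableSpace X] [MeasurableSpace X] [BorelSpace X] {ν : Measure X}
    [IsFiniteMeasure ν] {p : ℝ≥0∞} (hp1 : 1 ≤ p) (hp : p ≠ ∞) {g : X → ℝ}
    (hg0 : ∀ x, 0 ≤ g x) (hg : MemLp g p ν) {θ : ℝ≥0∞} (hθ : θ ≠ 0) :
    ∃ G : X → ℝ, (∃ K, LipschitzWith K G) ∧ (∀ x, 0 ≤ G x) ∧ eLpNorm (G - g) p ν ≤ θ := by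
  have := UniformSpace.secondCountable_of_separable X
  have hp0 : p ≠ 0 := (one_pos.trans_le hp1).ne'
  rcases isEmpty_or_nonempty X with hX | hX
  · exact ⟨0, ⟨0, fun x => hX.elim x⟩, fun x => hX.elim x, by simp [Measure.eq_zero_of_isEmpty]⟩
  have hθ2 : θ / 2 ≠ 0 := by simpa using hθ
  obtain ⟨b, hb, -⟩ := hg.exists_boundedContinuous_eLpNorm_sub_le hp hθ2
  set c : X → ℝ := fun x => max (b x) 0 with hc
  have c_cont : Continuous c := b.continuous.max continuous_const
  have c0 : ∀ x, 0 ≤ c x := fun x => le_max_right _ _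
  have cle : ∀ x, c x ≤ ‖b‖ := fun x =>
    max_le ((le_abs_self _).trans (b.norm_coe_le_norm x)) (norm_nonneg b)
  have hcg : eLpNorm (c - g) p ν ≤ θ / 2 := by
    refine (eLpNorm_mono fun x => ?_).trans hb
    rw [Pi.sub_apply, Pi.sub_apply, norm_sub_rev (g x)]
    have := abs_max_sub_max_le_abs (b x) (g x) 0
    rwa [max_eq_left (hg0 x)] at this
  set e : ℕ → X → ℝ := fun n x => ⨅ y, (c y + n * dist x y) with he
  have bdd : ∀ (n : ℕ) x, BddBelow (Set.range fun y => c y + n * dist x y) := fun n x => by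
    refine ⟨0, ?_⟩
    rintro _ ⟨y, rfl⟩
    have := c0 y
    positivity
  have e_lip : ∀ n : ℕ, LipschitzWith n (e n) := fun n => by
    refine lipschitzWith_ciInf (φ := fun y x => c y + n * dist x y) (fun y => ?_) (bdd n)
    refine LipschitzWith.of_le_add_mul _ fun x x' => ?_
    have := mul_le_mul_of_nonneg_left (dist_triangle x x' y) (Nat.cast_nonneg (α := ℝ) n)
    simp only [NNReal.coe_natCast]
    linarith
  have e0 : ∀ n x, 0 ≤ e n x := fun n x => le_ciInf fun y => by
    have := c0 y
    positivity
  have ele : ∀ n x, e n x ≤ c x := fun n x => by simpa using ciInf_le (bdd n x) x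
  have elim : ∀ x, Tendsto (fun n => e n x) atTop (𝓝 (c x)) := fun x => by
    refine tendsto_order.2 ⟨fun a ha => ?_, fun a ha => .of_forall fun n => (ele n x).trans_lt ha⟩
    obtain ⟨a', haa', ha'⟩ := exists_between ha
    obtain ⟨δ, hδ, h⟩ := Metric.eventually_nhds_iff.1 (c_cont.continuousAt.eventually_const_lt ha')
    obtain ⟨N, hN⟩ := exists_nat_ge (c x / δ)
    filter_upwards [eventually_ge_atTop N] with n hn
    refine haa'.trans_le (le_ciInf fun y => ?_)
    have hnd : 0 ≤ n * dist x y := by positivity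
    rcases lt_or_ge (dist y x) δ with hy | hy
    · linarith [h hy]
    · have h1 : c x ≤ n * δ := by
        rw [div_le_iff₀ hδ] at hN
        exact hN.trans (by gcongr)
      have h2 : (n : ℝ) * δ ≤ n * dist x y := by rw [dist_comm]; gcongr
      linarith [c0 y]
  have key : Tendsto (fun n => eLpNorm (fun x => ‖e n x - c x‖ₑ) p ν) atTop (𝓝 0) := by
    have := tendsto_eLpNorm_of_dominated (μ := ν) hp0 hp (F := fun n x => ‖e n x - c x‖ₑ)
      (f := fun _ => 0) (W := fun _ => ‖‖b‖‖ₑ) (fun n => ?_) ?_ (fun n x => ?_)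
      (.of_forall fun x => ?_)
    · simpa using this
    · exact ((e_lip n).continuous.sub c_cont).enorm.aemeasurable
    · rw [eLpNorm_enorm]
      exact (memLp_const _).2.ne
    · rw [enorm_le_iff_norm_le, norm_norm, Real.norm_eq_abs, abs_sub_comm,
        abs_of_nonneg (by linarith [ele n x])]
      linarith [e0 n x, cle x]
    · have := ((elim x).sub_const (c x)).enorm
      simpa using this
  obtain ⟨n, hn⟩ := (key.eventually_lt_const (pos_iff_ne_zero.2 hθ2)).exists
  rw [eLpNorm_enorm] at hn
  refine ⟨e n, ⟨_, e_lip n⟩, e0 n, ?_⟩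
  have h := eLpNorm_add_le (μ := ν) (p := p) (f := e n - c) (g := c - g)
    ((e_lip n).continuous.sub c_cont).aestronglyMeasurable
    (c_cont.aestronglyMeasurable.sub hg.1) hp1
  rw [sub_add_sub_cancel] at h
  calc _ ≤ _ := h
    _ ≤ θ / 2 + θ / 2 := add_le_add hn.le hcg
    _ = θ := ENNReal.add_halves θ

/-! ### Comparison of the energies, and slopes -/

/-- Two-point inequalities in `ℝ` for a Lipschitz function give membership in `LUG`. -/
theorem ofReal_mem_LUG {X : Type*} [MetricSpace X] [MeasurableSpace X] [BorelSpace X]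
    {v H : X → ℝ} {K : ℝ≥0} {δ : ℝ} (hH : LipschitzWith K H) (hH0 : ∀ x, 0 ≤ H x)
    (h : ∀ x y, dist x y ≤ δ → |v y - v x| ≤ (H x + H y) / 2 * dist x y) :
    (fun x => ENNReal.ofReal (H x)) ∈ LUG δ v := by
  refine ⟨IsPairUG.mem_UG (fun x y hxy => ?_) hH.continuous.measurable.ennreal_ofReal,
    fun x => (H x).toNNReal, 1 * K,
    (show LipschitzWith 1 Real.toNNReal from lipschitzWith_posPart).comp hH, rfl⟩
  rw [← ENNReal.ofReal_add (hH0 x) (hH0 y), edist_dist,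
    show (2 : ℝ≥0∞) = ENNReal.ofReal 2 by simp, ← ENNReal.ofReal_div_of_pos two_pos,
    ← ENNReal.ofReal_mul (by linarith [hH0 x, hH0 y])]
  exact ENNReal.ofReal_le_ofReal (h x y hxy)

theorem FChainLip_le {X : Type*} [MetricSpace X] [MeasurableSpace X] {p : ℝ≥0∞} {μ : Measure X}
    {v : X → ℝ} (hv : IsLip v) {δ : ℝ} (hδ : 0 < δ) {g : X → ℝ≥0∞} (hg : g ∈ LUG δ v) :
    FChainLip p μ v ≤ eLpNorm g p μ := by
  rw [FChainLip, if_pos hv]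
  exact (iInf₂_le δ hδ).trans (iInf₂_le g hg)

theorem FChain_le_FChainLip {X : Type*} [MetricSpace X] [MeasurableSpace X] (p : ℝ≥0∞)
    (μ : Measure X) (v : X → ℝ) : FChain p μ v ≤ FChainLip p μ v := by
  rw [FChainLip]
  split_ifs
  · exact iInf₂_mono fun ε _ => biInf_mono fun g hg => hg.1
  · exact le_top

/-- A continuous `ε`-upper gradient bounds the local Lipschitz constant pointwise. -/
theorem FAGS_le_FChainLip {X : Type*} [MetricSpace X] [MeasurableSpace X] (p : ℝ≥0∞)
    (μ : Measure X) (v : X → ℝ) : FAGS p μ v ≤ FChainLip p μ v := by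
  rw [FChainLip, FAGS]
  split_ifs
  swap
  · exact le_top
  refine le_iInf₂ fun ε (hε : 0 < ε) => le_iInf₂ fun g ⟨hg, f, K, hf, hgf⟩ => ?_
  refine eLpNorm_mono_enorm fun x => ?_
  subst hgf
  simp only [enorm_eq_self]
  have hlim : Tendsto (fun t : ℝ => ((f x + K * t.toNNReal : ℝ≥0) : ℝ≥0∞)) (𝓝[>] 0)
      (𝓝 (f x)) := by
    refine ENNReal.tendsto_coe.2 (Tendsto.mono_left ?_ nhdsWithin_le_nhds)
    have : Continuous fun t : ℝ => f x + K * t.toNNReal := by fun_prop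
    simpa using this.tendsto 0
  refine le_of_tendsto_of_tendsto (tendsto_slope v x) hlim ?_
  filter_upwards [Ioc_mem_nhdsGT hε] with t ht
  refine iSup₂_le fun y hy => ?_
  have hyx : dist y x < t := hy.1
  have hd : 0 < dist y x := dist_pos.2 hy.2
  have h1 := IsPairUG.of_mem_UG hg y x (hyx.le.trans ht.2)
  have h2 : (f y : ℝ) ≤ f x + K * t := by
    have h3 : (f y : ℝ) - f x ≤ K * dist y x := (abs_le.1 (hf.dist_le_mul y x)).2
    have h4 : (K : ℝ) * dist y x ≤ K * t := by gcongr
    linarith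
  rw [ENNReal.ofReal_le_iff_le_toReal ENNReal.coe_ne_top, ENNReal.coe_toReal, div_le_iff₀ hd]
  rw [ENNReal.ofReal_le_iff_le_toReal (by finiteness)] at h1
  simp only [ENNReal.toReal_mul, ENNReal.toReal_div, ENNReal.toReal_ofNat, edist_dist,
    ENNReal.toReal_ofReal dist_nonneg, ← ENNReal.coe_add, ENNReal.coe_toReal] at h1
  rw [abs_sub_comm]
  refine h1.trans (mul_le_mul_of_nonneg_right ?_ hd.le)
  push_cast
  rw [Real.coe_toNNReal _ ht.1.le]
  have : 0 ≤ K * t := mul_nonneg K.2 ht.1.le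
  linarith

theorem measurable_slope {X : Type*} [MetricSpace X] [MeasurableSpace X] [BorelSpace X]
    {u : X → ℝ} (hu : Continuous u) (ε : ℝ) : Measurable (slope u ε) := by
  refine LowerSemicontinuous.measurable fun x a ha => ?_
  obtain ⟨y, hy⟩ := lt_iSup_iff.1 ha
  obtain ⟨⟨hyx, hne⟩, hlt⟩ := lt_iSup_iff.1 hy
  have hd : dist y x ≠ 0 := (dist_pos.2 hne).ne'
  have hc : ContinuousAt (fun z => ENNReal.ofReal (|u y - u z| / dist y z)) x :=
    ENNReal.continuous_ofReal.continuousAt.comp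
      ((by fun_prop : Continuous fun z => |u y - u z|).continuousAt.div
        (by fun_prop : Continuous fun z => dist y z).continuousAt hd)
  have hball : ∀ᶠ z in 𝓝 x, dist y z < ε :=
    (by fun_prop : Continuous fun z => dist y z).continuousAt.eventually_lt_const hyx
  have hne' : ∀ᶠ z in 𝓝 x, z ≠ y := isOpen_ne.mem_nhds (Ne.symm hne)
  filter_upwards [hc.eventually_const_lt hlt, hball, hne'] with z h1 h2 h3
  exact h1.trans_le (le_iSup₂ (f := fun w (_ : w ∈ Metric.ball z ε \ {z}) =>
    ENNReal.ofReal (|u w - u z| / dist w z)) y ⟨h2, Ne.symm h3⟩)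

theorem slope_le {X : Type*} [MetricSpace X] {u : X → ℝ} {K : ℝ≥0} (hu : LipschitzWith K u)
    (ε : ℝ) (x : X) : slope u ε x ≤ K := by
  refine iSup₂_le fun y hy => ENNReal.ofReal_le_of_le_toReal ?_
  rw [div_le_iff₀ (dist_pos.2 hy.2)]
  exact hu.dist_le_mul y x

theorem isPairUG_slope {X : Type*} [MetricSpace X] (u : X → ℝ) {ε' ε : ℝ} (h : ε' < ε) :
    IsPairUG ε' u (slope u ε) := by
  have key : ∀ x y, dist x y ≤ ε' →
      ENNReal.ofReal |u y - u x| ≤ slope u ε x * edist x y := fun x y hxy => by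
    rcases eq_or_ne y x with rfl | hne
    · simp
    have hd : 0 < dist y x := dist_pos.2 hne
    calc ENNReal.ofReal |u y - u x|
        = ENNReal.ofReal (|u y - u x| / dist y x) * edist x y := by
          rw [edist_comm, edist_dist, ← ENNReal.ofReal_mul (by positivity),
            div_mul_cancel₀ _ hd.ne']
      _ ≤ _ := by
          gcongr
          refine le_iSup₂ (f := fun w (_ : w ∈ Metric.ball x ε \ {x}) =>
            ENNReal.ofReal (|u w - u x| / dist w x)) y ⟨?_, hne⟩
          rw [Metric.mem_ball, dist_comm]
          exact hxy.trans_lt h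
  intro x y hxy
  have h1 := key x y hxy
  have h2 := key y x (by rwa [dist_comm])
  rw [abs_sub_comm, edist_comm] at h2
  calc ENNReal.ofReal |u y - u x|
      = ENNReal.ofReal |u y - u x| / 2 + ENNReal.ofReal |u y - u x| / 2 :=
        (ENNReal.add_halves _).symm
    _ ≤ slope u ε x * edist x y / 2 + slope u ε y * edist x y / 2 := by gcongr
    _ = _ := by simp only [div_eq_mul_inv]; ring

/-! ### Lipschitz approximation of functions of bounded support -/

/-- The approximation for a function of bounded support. Outside of the set `A` where
`max (g, 2 |u| / ε) ≤ M` and `g` is at most a Lipschitz approximation of it plus `η`, Chebyshev's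
inequality makes `M` times the indicator function small in `L^p`; the Lipschitz extension of `u`
from `A`, whose upper gradient is bounded by a multiple of `M` outside of `A`, is therefore close
to `u` in energy. -/
theorem exists_lipschitz_approx_of_bounded_support {X : Type*} [MetricSpace X]
    [TopologicalSpace.SeparableSpace X] [MeasurableSpace X] [BorelSpace X] {μ : Measure X}
    {p : ℝ≥0∞} (hp1 : 1 ≤ p) (hp : p ≠ ∞) {o : X} {ρ : ℝ}
    (hfin : μ (Metric.ball o (ρ + 2)) < ∞) {u : X → ℝ} (hu : MemLp u p μ)
    (hu0 : ∀ x, ρ ≤ dist x o → u x = 0) {g : X → ℝ≥0∞} (hg : AEMeasurable g μ)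
    (hgn : eLpNorm g p μ ≠ ∞) (hg0 : ∀ x, ρ ≤ dist x o → g x = 0) {ε : ℝ} (hε : 0 < ε)
    (hpair : IsPairUG ε u g) {θ : ℝ≥0∞} (hθ0 : θ ≠ 0) (hθ : θ ≠ ∞) :
    ∃ v, MemLp v p μ ∧ IsLip v ∧ eLpNorm (v - u) p μ ≤ θ ∧
      FChainLip p μ v ≤ eLpNorm g p μ + θ := by
  have := UniformSpace.secondCountable_of_separable X
  have hp0 : p ≠ 0 := (one_pos.trans_le hp1).ne'
  set B := Metric.ball o (ρ + 2) with hB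
  set ν := μ.restrict B with hν
  have : IsFiniteMeasure ν := ⟨by simpa [hν] using hfin⟩
  have hνμ : ν ≤ μ := Measure.restrict_le_self
  -- `τ` is chosen such that `10 τ ≤ θ` and `2 ε τ ≤ θ`.
  obtain ⟨τ, hτ0, hτ10, hτε⟩ : ∃ τ : ℝ≥0∞, τ ≠ 0 ∧ 10 * τ ≤ θ ∧
      ENNReal.ofReal ε * (τ + τ) ≤ θ := by
    set s := 10 + 2 * ENNReal.ofReal ε
    have hs : s ≠ ∞ := by finiteness
    refine ⟨θ / s, (ENNReal.div_pos hθ0 hs).ne', ?_, ?_⟩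
    · calc 10 * (θ / s) ≤ s * (θ / s) := by gcongr; exact le_self_add
        _ ≤ θ := ENNReal.mul_div_le
    · calc _ = 2 * ENNReal.ofReal ε * (θ / s) := by ring
        _ ≤ s * (θ / s) := by gcongr; exact le_add_self
        _ ≤ θ := ENNReal.mul_div_le
  -- The function `W` controls both `g` and the oscillation of `u` at scales larger than `ε`.
  set W : X → ℝ≥0∞ := fun x => max (g x) (ENNReal.ofReal (2 / ε) * ‖u x‖ₑ) with hW
  have W_meas : AEMeasurable W μ := hg.max (hu.1.aemeasurable.enorm.const_mul _)
  have W_norm : eLpNorm W p μ ≠ ∞ := by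
    have h1 : eLpNorm (g + fun x => ENNReal.ofReal (2 / ε) * ‖u x‖ₑ) p μ < ∞ := by
      refine (eLpNorm_add_le hg.aestronglyMeasurable
        (hu.1.aemeasurable.enorm.const_mul _).aestronglyMeasurable hp1).trans_lt ?_
      rw [eLpNorm_const_mul_ennreal hp0 hp ENNReal.ofReal_ne_top, eLpNorm_enorm]
      exact ENNReal.add_lt_top.2 ⟨hgn.lt_top, ENNReal.mul_lt_top ENNReal.ofReal_lt_top hu.2⟩
    refine ((eLpNorm_mono_enorm fun x => ?_).trans_lt h1).ne
    simp only [enorm_eq_self, hW, Pi.add_apply]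
    exact max_le le_self_add le_add_self
  obtain ⟨n, hn⟩ : ∃ n : ℕ,
      eLpNorm ({x | ((n + 1 : ℕ) : ℝ≥0∞) < W x}.indicator W) p μ < τ := by
    have := tendsto_eLpNorm_of_dominated (μ := μ) hp0 hp (f := fun _ => 0) (W := W)
      (F := fun (n : ℕ) => {x | ((n + 1 : ℕ) : ℝ≥0∞) < W x}.indicator W) (fun n => ?_) W_norm
      (fun n x => Set.indicator_le_self _ _ _) ?_
    · rw [eLpNorm_zero'] at this
      exact (this.eventually_lt_const (pos_iff_ne_zero.2 hτ0)).exists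
    · exact W_meas.indicator₀ (nullMeasurableSet_lt aemeasurable_const W_meas)
    · filter_upwards [ae_lt_top_of_eLpNorm_ne_top hp0 hp W_meas W_norm] with x hx
      obtain ⟨N, hN⟩ := ENNReal.exists_nat_gt hx.ne
      refine tendsto_const_nhds.congr' ?_
      filter_upwards [eventually_ge_atTop N] with n hnN
      rw [Set.indicator_of_notMem]
      rw [Set.mem_ofPred_eq, not_lt]
      exact hN.le.trans (by exact_mod_cast hnN.trans n.le_succ)
  set M : ℝ := n + 1 with hM
  have hM1 : 1 ≤ M := by simp [hM]
  have hM0 : 0 < M := by linarith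
  have hMcast : ENNReal.ofReal M = ((n + 1 : ℕ) : ℝ≥0∞) := by
    rw [hM, ← ENNReal.ofReal_natCast]; simp
  rw [← hMcast] at hn
  set T : X → ℝ≥0∞ := {x | ENNReal.ofReal M < W x}.indicator W with hT
  obtain ⟨η, hη0, hη1, hητ⟩ : ∃ η : ℝ, 0 < η ∧ η ≤ 1 ∧
      eLpNorm (fun _ : X => ENNReal.ofReal (4 * η)) p ν ≤ τ := by
    have h1 : Tendsto (fun η : ℝ => ENNReal.ofReal (4 * η) * eLpNorm (fun _ : X => (1 : ℝ≥0∞)) p ν)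
        (𝓝[>] 0) (𝓝 0) := by
      have hc : Continuous fun η : ℝ => ENNReal.ofReal (4 * η) :=
        ENNReal.continuous_ofReal.comp (by fun_prop)
      have := (hc.tendsto 0).mono_left (nhdsWithin_le_nhds (s := Set.Ioi 0))
      have h1 : eLpNorm (fun _ : X => (1 : ℝ≥0∞)) p ν ≠ ∞ := by
        have := (memLp_const (μ := ν) (p := p) (1 : ℝ)).2.ne
        rw [← eLpNorm_enorm] at this
        simpa using this
      have := ENNReal.Tendsto.mul_const this (Or.inr h1)
      simpa using this
    obtain ⟨η, h, hη⟩ := ((h1.eventually_lt_const (pos_iff_ne_zero.2 hτ0)).and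
      (Ioc_mem_nhdsGT one_pos)).exists
    refine ⟨η, hη.1, hη.2, ?_⟩
    rw [← eLpNorm_const_mul_ennreal hp0 hp ENNReal.ofReal_ne_top] at h
    simpa using h.le
  have hηM : η ≤ M := hη1.trans hM1
  have g_lt_top := ae_lt_top_of_eLpNorm_ne_top hp0 hp hg hgn
  have gr_mem : MemLp (fun x => (g x).toReal) p ν := by
    refine MemLp.mono_measure hνμ ⟨hg.ennreal_toReal.aestronglyMeasurable, ?_⟩
    refine (eLpNorm_mono_enorm fun x => ?_).trans_lt hgn.lt_top
    rw [enorm_eq_self, Real.enorm_of_nonneg ENNReal.toReal_nonneg]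
    exact ENNReal.ofReal_toReal_le
  set q : ℝ≥0∞ := ENNReal.ofReal (M / η) with hq
  have hq1 : 1 ≤ q := by
    rw [hq, ENNReal.one_le_ofReal, one_le_div hη0]; exact hηM
  obtain ⟨G₀, ⟨Λ, hG₀⟩, hG₀0, hG₀n⟩ := exists_lipschitz_eLpNorm_sub_le hp1 hp
    (fun x => ENNReal.toReal_nonneg) gr_mem
    (ENNReal.div_pos hτ0 (ENNReal.ofReal_ne_top : q ≠ ∞)).ne'
  set D : X → ℝ≥0∞ := fun x => q * ‖G₀ x - (g x).toReal‖ₑ with hD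
  have D_norm : eLpNorm D p ν ≤ τ := by
    rw [hD, eLpNorm_const_mul_ennreal hp0 hp ENNReal.ofReal_ne_top, eLpNorm_enorm]
    calc _ ≤ q * (τ / q) := by gcongr; exact hG₀n
      _ ≤ τ := ENNReal.mul_div_le
  have T_norm : eLpNorm T p ν ≤ τ := (eLpNorm_mono_measure _ hνμ).trans hn.le
  have T_meas : AEMeasurable T ν :=
    (W_meas.indicator₀ (nullMeasurableSet_lt aemeasurable_const W_meas)).mono_measure hνμ
  have D_meas : AEMeasurable D ν :=
    ((hG₀.continuous.aemeasurable.sub gr_mem.1.aemeasurable).enorm).const_mul _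
  have TD_meas := T_meas.add D_meas
  have TD_norm : eLpNorm (T + D) p ν ≤ τ + τ :=
    (eLpNorm_add_le T_meas.aestronglyMeasurable D_meas.aestronglyMeasurable hp1).trans
      (add_le_add T_norm D_norm)
  set G : X → ℝ := fun x => min (G₀ x + η) M with hG
  have T_eq : ∀ x, ENNReal.ofReal M < W x → T x = W x := fun x hx =>
    Set.indicator_of_mem (s := {x | ENNReal.ofReal M < W x}) hx W
  have G_lip : LipschitzWith (Λ + 0) G := (hG₀.add (LipschitzWith.const η)).min_const M
  have hG0 : ∀ x, 0 ≤ G x := fun x => le_min (by linarith [hG₀0 x]) hM0.le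
  have hGM : ∀ x, G x ≤ M := fun x => min_le_right _ _
  set A : Set X := {x | W x ≤ ENNReal.ofReal M ∧ g x ≤ ENNReal.ofReal (G₀ x + η)} with hA
  have g_le : ∀ x ∈ A, g x ≤ ENNReal.ofReal (G x) := fun x hx => by
    rw [hG, ENNReal.ofReal_min]
    exact le_min hx.2 ((le_max_left _ _).trans hx.1)
  have u_le : ∀ x, W x ≤ ENNReal.ofReal M → |u x| ≤ ε / 2 * M := fun x hx => by
    have h1 := (le_max_right _ _).trans hx
    rw [Real.enorm_eq_ofReal_abs, ← ENNReal.ofReal_mul (by positivity),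
      ENNReal.ofReal_le_ofReal_iff hM0.le, div_mul_eq_mul_div, div_le_iff₀ hε] at h1
    linarith
  have A_far : ∀ x, ρ ≤ dist x o → x ∈ A := fun x hx => by
    simp [hA, hW, hu0 x hx, hg0 x hx]
  have A_compl : ∀ x, x ∉ A → ENNReal.ofReal M ≤ T x + D x := fun x hx => by
    rcases lt_or_ge (ENNReal.ofReal M) (W x) with h | h
    · rw [T_eq x h]
      exact h.le.trans le_self_add
    · have h1 : ENNReal.ofReal (G₀ x + η) < g x := by
        by_contra! h2; exact hx ⟨h, h2⟩
      have hgt : g x ≠ ∞ := (((le_max_left _ _).trans h).trans_lt ENNReal.ofReal_lt_top).ne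
      rw [ENNReal.ofReal_lt_iff_lt_toReal (by linarith [hG₀0 x]) hgt] at h1
      refine le_trans ?_ le_add_self
      simp only [hD]
      rw [hq, Real.enorm_eq_ofReal_abs, ← ENNReal.ofReal_mul (by positivity)]
      refine ENNReal.ofReal_le_ofReal ?_
      rw [div_mul_eq_mul_div, le_div_iff₀ hη0, abs_sub_comm]
      exact mul_le_mul_of_nonneg_left (by linarith [le_abs_self ((g x).toReal - G₀ x)]) hM0.le
  have pairA : ∀ x ∈ A, ∀ y ∈ A, dist x y ≤ ε → |u x - u y| ≤ (G x + G y) / 2 * dist x y := by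
    intro x hx y hy hxy
    have h1 : ENNReal.ofReal |u y - u x| ≤ ENNReal.ofReal ((G x + G y) / 2 * dist x y) := by
      rw [ENNReal.ofReal_mul (by linarith [hG0 x, hG0 y]), ENNReal.ofReal_div_of_pos two_pos,
        ENNReal.ofReal_add (hG0 x) (hG0 y), ← edist_dist]
      refine (hpair x y hxy).trans ?_
      have := g_le x hx
      have := g_le y hy
      simp only [ENNReal.ofReal_ofNat]
      gcongr
    rw [ENNReal.ofReal_le_ofReal_iff (mul_nonneg (by linarith [hG0 x, hG0 y]) dist_nonneg)] at h1
    rwa [abs_sub_comm]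
  have lipA : ∀ x ∈ A, ∀ y ∈ A, |u x - u y| ≤ M * dist x y := by
    intro x hx y hy
    rcases le_total (dist x y) ε with h | h
    · refine (pairA x hx y hy h).trans (mul_le_mul_of_nonneg_right ?_ dist_nonneg)
      linarith [hGM x, hGM y]
    · have h1 := abs_sub (u x) (u y)
      have := u_le x hx.1
      have := u_le y hy.1
      nlinarith
  obtain ⟨f, H, ⟨Kf, hf⟩, ⟨KH, hH⟩, hfu, hH0, hHA, hHle, δ, hδ, hfH⟩ :=
    exists_lipschitz_extension_upperGradient hε hη0 hηM G_lip hG0 hGM lipA pairA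
  -- Truncating `f` keeps it bounded outside of `A`, where it is unrelated to `u`.
  set c := ε / 2 * M with hc
  have hc0 : 0 < c := by positivity
  set v : X → ℝ := fun x => max (-c) (min c (f x)) with hv
  have v_lip : LipschitzWith Kf v := (hf.const_min c).const_max (-c)
  have v_abs : ∀ x, |v x| ≤ c := fun x =>
    abs_le.2 ⟨le_max_left _ _, max_le (by linarith) (min_le_left _ _)⟩
  have v_sub : ∀ x y, |v y - v x| ≤ |f y - f x| := fun x y => by
    simp only [hv]
    rw [max_comm (-c), max_comm (-c)]
    refine (abs_max_sub_max_le_abs _ _ _).trans ?_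
    rw [min_comm c, min_comm c]
    have h := abs_min_sub_min_le_max (f y) c (f x) c
    rwa [sub_self, abs_zero, max_eq_left (abs_nonneg _)] at h
  have vu : ∀ x ∈ A, v x = u x := fun x hx => by
    have h := abs_le.1 (u_le x hx.1)
    simp only [hv]
    rw [hfu hx, min_eq_right h.2, max_eq_right h.1]
  have v_far : ∀ x, ρ ≤ dist x o → v x = 0 := fun x hx => by
    rw [vu x (A_far x hx), hu0 x hx]
  -- Since `v` is supported in the ball of radius `ρ`, its upper gradient can be cut off.
  set C := 5 * M + 3 * η with hC
  have hC0 : 0 < C := by positivity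
  have H_le_C : ∀ x, H x ≤ C := fun x => by linarith [hHle x, hGM x]
  set χ : X → ℝ := fun x => max 0 (min C (C • (ρ + 2 - dist x o))) with hχ
  have χ_lip : LipschitzWith (‖C‖₊ * (0 + 1)) χ := by
    have h1 : LipschitzWith (0 + 1) fun x => ρ + 2 - dist x o :=
      (LipschitzWith.const (ρ + 2)).sub (LipschitzWith.dist_left o)
    exact (((lipschitzWith_smul C).comp h1).const_min C).const_max 0
  set H' : X → ℝ := fun x => min (H x) (χ x) with hH'
  have H'_lip := hH.min χ_lip
  have H'0 : ∀ x, 0 ≤ H' x := fun x => le_min (hH0 x) (le_max_left _ _)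
  have H'_near : ∀ x, dist x o ≤ ρ + 1 → H' x = H x := fun x hx => by
    refine min_eq_left ((H_le_C x).trans ((le_min le_rfl ?_).trans (le_max_right _ _)))
    rw [smul_eq_mul]
    nlinarith
  have H'_far : ∀ x, ρ + 2 ≤ dist x o → H' x = 0 := fun x hx => by
    refine le_antisymm ((min_le_right _ _).trans (max_le le_rfl ((min_le_right _ _).trans ?_)))
      (H'0 x)
    rw [smul_eq_mul]
    nlinarith
  have hvH' : ∀ x y, dist x y ≤ min δ 1 → |v y - v x| ≤ (H' x + H' y) / 2 * dist x y := by
    intro x y hxy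
    have h1 : dist x y ≤ 1 := hxy.trans (min_le_right _ _)
    by_cases h : ρ ≤ dist x o ∧ ρ ≤ dist y o
    · rw [v_far x h.1, v_far y h.2, sub_zero, abs_zero]
      exact mul_nonneg (by linarith [H'0 x, H'0 y]) dist_nonneg
    · have h2 := dist_triangle x y o
      have h3 := dist_triangle_left y o x
      have hx : dist x o ≤ ρ + 1 := by by_contra! hx; exact h ⟨by linarith, by linarith⟩
      have hy : dist y o ≤ ρ + 1 := by by_contra! hy; exact h ⟨by linarith, by linarith⟩
      rw [H'_near x hx, H'_near y hy]
      exact (v_sub x y).trans (hfH x y (hxy.trans (min_le_left _ _)))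
  have v_isLip : IsLip v := ⟨_, v_lip⟩
  have vu_norm : eLpNorm (v - u) p μ ≤ ENNReal.ofReal ε * (τ + τ) := by
    have hsupp : Function.support (v - u) ⊆ B := fun x hx => by
      by_contra hxB
      have : ρ ≤ dist x o := by
        rw [hB, Metric.mem_ball, not_lt] at hxB; linarith
      exact hx (by rw [Pi.sub_apply, v_far x this, hu0 x this, sub_zero])
    rw [← eLpNorm_restrict_eq_of_support_subset hsupp]
    calc eLpNorm (v - u) p ν
        ≤ eLpNorm (fun x => ENNReal.ofReal ε * (T + D) x) p ν := by
          refine eLpNorm_mono_enorm fun x => ?_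
          rw [enorm_eq_self, Pi.sub_apply]
          by_cases hx : x ∈ A
          · simp [vu x hx]
          have hcM : ENNReal.ofReal c = ENNReal.ofReal ε / 2 * ENNReal.ofReal M := by
            rw [hc, ENNReal.ofReal_mul (by positivity), ENNReal.ofReal_div_of_pos two_pos]
            simp
          have h1 : ‖v x‖ₑ ≤ ENNReal.ofReal ε / 2 * (T x + D x) := by
            rw [Real.enorm_eq_ofReal_abs]
            refine (ENNReal.ofReal_le_ofReal (v_abs x)).trans ?_
            rw [hcM]
            gcongr
            exact A_compl x hx
          have h2 : ‖u x‖ₑ ≤ ENNReal.ofReal ε / 2 * (T x + D x) := by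
            rcases lt_or_ge (ENNReal.ofReal M) (W x) with h | h
            · have hTW : T x = W x := T_eq x h
              calc ‖u x‖ₑ = ENNReal.ofReal ε / 2 * (ENNReal.ofReal (2 / ε) * ‖u x‖ₑ) := by
                    rw [← mul_assoc, ← ENNReal.ofReal_ofNat 2, ← ENNReal.ofReal_div_of_pos two_pos,
                      ← ENNReal.ofReal_mul (by positivity), div_mul_div_comm, mul_comm ε 2,
                      div_self (by positivity), ENNReal.ofReal_one, one_mul]
                _ ≤ ENNReal.ofReal ε / 2 * (T x + D x) := by
                    gcongr
                    rw [hTW]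
                    exact (le_max_right _ _).trans le_self_add
            · rw [Real.enorm_eq_ofReal_abs]
              refine (ENNReal.ofReal_le_ofReal (u_le x h)).trans ?_
              rw [hcM]
              gcongr
              exact A_compl x hx
          calc ‖v x - u x‖ₑ ≤ ‖v x‖ₑ + ‖u x‖ₑ := enorm_sub_le
            _ ≤ ENNReal.ofReal ε / 2 * (T x + D x) + ENNReal.ofReal ε / 2 * (T x + D x) :=
              add_le_add h1 h2
            _ = ENNReal.ofReal ε * (T x + D x) := by rw [← add_mul, ENNReal.add_halves]
      _ ≤ _ := by
          rw [eLpNorm_const_mul_ennreal hp0 hp ENNReal.ofReal_ne_top]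
          gcongr
  refine ⟨v, ?_, v_isLip, vu_norm.trans hτε, ?_⟩
  · have h1 : MemLp (v - u) p μ :=
      ⟨v_lip.continuous.aestronglyMeasurable.sub hu.1, vu_norm.trans_lt (hτε.trans_lt hθ.lt_top)⟩
    simpa using h1.add hu
  · refine (FChainLip_le v_isLip (lt_min hδ one_pos)
      (ofReal_mem_LUG H'_lip H'0 hvH')).trans ?_
    have hsupp : Function.support (fun x => ENNReal.ofReal (H' x)) ⊆ B := fun x hx => by
      by_contra hxB
      rw [hB, Metric.mem_ball, not_lt] at hxB
      exact hx (by simp [H'_far x hxB])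
    rw [← eLpNorm_restrict_eq_of_support_subset hsupp]
    set E : X → ℝ≥0∞ := fun _ => ENNReal.ofReal (4 * η) with hE
    have hbound : ∀ᵐ x ∂ν, ‖ENNReal.ofReal (H' x)‖ₑ
        ≤ ‖(g + (D + (E + fun x => 4 * (T + D) x))) x‖ₑ := by
      filter_upwards [ae_mono hνμ g_lt_top] with x hgx
      simp only [enorm_eq_self, Pi.add_apply]
      have h1 : ENNReal.ofReal (G x + 3 * η) ≤ g x + D x + ENNReal.ofReal (4 * η) := by
        have h2 : G x + 3 * η ≤ (g x).toReal + |G₀ x - (g x).toReal| + 4 * η := by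
          have h3 : G x ≤ G₀ x + η := min_le_left _ _
          linarith [le_abs_self (G₀ x - (g x).toReal)]
        refine (ENNReal.ofReal_le_ofReal h2).trans ?_
        rw [ENNReal.ofReal_add (by positivity) (by positivity),
          ENNReal.ofReal_add (by positivity) (by positivity), ENNReal.ofReal_toReal hgx.ne,
          ← Real.enorm_eq_ofReal_abs]
        gcongr
        exact le_mul_of_one_le_left zero_le hq1
      have h3 : ENNReal.ofReal (H' x) ≤ ENNReal.ofReal (G x + 3 * η) + 4 * (T x + D x) := by
        refine (ENNReal.ofReal_le_ofReal (min_le_left _ _)).trans ?_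
        by_cases hx : x ∈ A
        · rw [hHA x hx]; exact le_self_add
        · refine (ENNReal.ofReal_le_ofReal (hHle x)).trans (ENNReal.ofReal_add_le.trans ?_)
          rw [ENNReal.ofReal_mul (by norm_num), ENNReal.ofReal_ofNat]
          gcongr
          exact A_compl x hx
      calc _ ≤ _ := h3
        _ ≤ g x + D x + ENNReal.ofReal (4 * η) + 4 * (T x + D x) := by gcongr
        _ = _ := by simp only [hE]; ring
    have m4 : AEMeasurable (fun x => 4 * (T + D) x) ν := TD_meas.const_mul _
    have mE : AEMeasurable E ν := aemeasurable_const
    calc _ ≤ _ := eLpNorm_mono_enorm_ae hbound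
      _ ≤ eLpNorm g p ν + (eLpNorm D p ν + (eLpNorm E p ν
            + eLpNorm (fun x => 4 * (T + D) x) p ν)) := by
          refine (eLpNorm_add_le (hg.mono_measure hνμ).aestronglyMeasurable
            (D_meas.add (mE.add m4)).aestronglyMeasurable hp1).trans (add_le_add le_rfl ?_)
          refine (eLpNorm_add_le D_meas.aestronglyMeasurable
            (mE.add m4).aestronglyMeasurable hp1).trans (add_le_add le_rfl ?_)
          exact eLpNorm_add_le mE.aestronglyMeasurable m4.aestronglyMeasurable hp1
      _ ≤ eLpNorm g p μ + (τ + (τ + 4 * (τ + τ))) := by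
          rw [eLpNorm_const_mul_ennreal hp0 hp (c := 4) (by finiteness)]
          exact add_le_add (eLpNorm_mono_measure _ hνμ)
            (add_le_add D_norm (add_le_add hητ (by gcongr)))
      _ = eLpNorm g p μ + 10 * τ := by ring
      _ ≤ _ := by gcongr

/-! ### Cutoff functions -/

/-- A cutoff function, equal to `1` on the ball of radius `R` about `o` and to `0` outside of the
ball of radius `2 R`. -/
noncomputable def cutoff {X : Type*} [MetricSpace X] (o : X) (R : ℝ) (x : X) : ℝ :=
  max 0 (min 1 (2 - dist x o / R))

section cutoff

variable {X : Type*} [MetricSpace X] {o : X} {R : ℝ}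

theorem cutoff_nonneg (x : X) : 0 ≤ cutoff o R x := le_max_left _ _

theorem cutoff_le_one (x : X) : cutoff o R x ≤ 1 := max_le zero_le_one (min_le_left _ _)

theorem cutoff_eq_one (hR : 0 < R) {x : X} (hx : dist x o ≤ R) : cutoff o R x = 1 := by
  have : dist x o / R ≤ 1 := (div_le_one hR).2 hx
  rw [cutoff, min_eq_left (by linarith), max_eq_right zero_le_one]

theorem cutoff_eq_zero (hR : 0 < R) {x : X} (hx : 2 * R ≤ dist x o) : cutoff o R x = 0 := by
  have : 2 ≤ dist x o / R := (le_div_iff₀ hR).2 hx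
  rw [cutoff, max_eq_left]
  exact (min_le_right _ _).trans (by linarith)

theorem lipschitzWith_cutoff (o : X) (R : ℝ) : LipschitzWith ‖R⁻¹‖₊ (cutoff o R) := by
  have h1 : LipschitzWith (0 + ‖R⁻¹‖₊ * 1) fun x => 2 - R⁻¹ • dist x o :=
    (LipschitzWith.const 2).sub ((lipschitzWith_smul R⁻¹).comp (LipschitzWith.dist_left o))
  have h2 := (h1.const_min 1).const_max 0
  simp only [zero_add, mul_one, smul_eq_mul, inv_mul_eq_div] at h2
  exact h2

/-- The Leibniz rule for the cutoff of a function. -/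
theorem IsPairUG.mul_cutoff (hR : 0 < R) {ε : ℝ} (hε : ε ≤ 1) {u : X → ℝ} {g : X → ℝ≥0∞}
    (h : IsPairUG ε u g) :
    IsPairUG ε (fun x => u x * cutoff o R x)
      ((Metric.ball o (2 * R + 1)).indicator fun x => g x + ENNReal.ofReal R⁻¹ * ‖u x‖ₑ) := by
  intro x y hxy
  by_cases hxy' : x ∈ Metric.ball o (2 * R + 1) ∧ y ∈ Metric.ball o (2 * R + 1)
  · rw [Set.indicator_of_mem hxy'.1, Set.indicator_of_mem hxy'.2]
    -- The symmetric form of the product rule keeps the average of `g` at the two points.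
    have h1 : |u y * cutoff o R y - u x * cutoff o R x|
        ≤ |u y - u x| + R⁻¹ * ((|u x| + |u y|) / 2) * dist x y := by
      have e : u y * cutoff o R y - u x * cutoff o R x
          = (u y - u x) * ((cutoff o R x + cutoff o R y) / 2)
            + (u x + u y) / 2 * (cutoff o R y - cutoff o R x) := by ring
      have h2 : |cutoff o R y - cutoff o R x| ≤ R⁻¹ * dist x y := by
        have := (lipschitzWith_cutoff o R).dist_le_mul y x
        rwa [Real.dist_eq, coe_nnnorm, Real.norm_of_nonneg (inv_pos.2 hR).le, dist_comm] at this
      have h3 : |(cutoff o R x + cutoff o R y) / 2| ≤ 1 := by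
        have := cutoff_nonneg (o := o) (R := R) x
        have := cutoff_nonneg (o := o) (R := R) y
        have := cutoff_le_one (o := o) (R := R) x
        have := cutoff_le_one (o := o) (R := R) y
        rw [abs_of_nonneg (by linarith)]
        linarith
      have h4 : |(u x + u y) / 2| ≤ (|u x| + |u y|) / 2 := by
        rw [abs_div, abs_two]
        have := abs_add_le (u x) (u y)
        linarith
      rw [e]
      refine (abs_add_le _ _).trans ?_
      rw [abs_mul, abs_mul]
      refine add_le_add (mul_le_of_le_one_right (abs_nonneg _) h3)
        ((mul_le_mul h4 h2 (abs_nonneg _) (by positivity)).trans_eq (by ring))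
    calc ENNReal.ofReal |u y * cutoff o R y - u x * cutoff o R x|
        ≤ ENNReal.ofReal |u y - u x|
          + ENNReal.ofReal (R⁻¹ * ((|u x| + |u y|) / 2) * dist x y) :=
          (ENNReal.ofReal_le_ofReal h1).trans ENNReal.ofReal_add_le
      _ ≤ (g x + g y) / 2 * edist x y
          + ENNReal.ofReal R⁻¹ * ((‖u x‖ₑ + ‖u y‖ₑ) / 2) * edist x y := by
          refine add_le_add (h x y hxy) (le_of_eq ?_)
          have := inv_pos.2 hR
          rw [ENNReal.ofReal_mul (by positivity), ENNReal.ofReal_mul (by positivity),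
            ENNReal.ofReal_div_of_pos two_pos, ENNReal.ofReal_add (abs_nonneg _) (abs_nonneg _),
            ← Real.enorm_eq_ofReal_abs, ← Real.enorm_eq_ofReal_abs, ← edist_dist,
            ENNReal.ofReal_ofNat]
      _ = _ := by simp only [div_eq_mul_inv]; ring
  · have h0 : ∀ z, 2 * R ≤ dist z o → u z * cutoff o R z = 0 := fun z hz => by
      rw [cutoff_eq_zero hR hz, mul_zero]
    have h2 := dist_triangle x y o
    have h3 := dist_triangle_left y o x
    simp only [Metric.mem_ball] at hxy'
    have hx : 2 * R ≤ dist x o := by by_contra! hx; exact hxy' ⟨by linarith, by linarith⟩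
    have hy : 2 * R ≤ dist y o := by by_contra! hy; exact hxy' ⟨by linarith, by linarith⟩
    simp [h0 x hx, h0 y hy]

end cutoff

/-! ### Lipschitz approximation of `p`-integrable functions -/

/-- A `p`-integrable function which has on every ball, at some scale, an upper gradient of norm
close to `a` is approximated by Lipschitz functions of energy `FChainLip` close to `a`. -/
theorem exists_lipschitz_approx {X : Type*} [MetricSpace X]
    [TopologicalSpace.SeparableSpace X] [MeasurableSpace X] [BorelSpace X] {μ : Measure X}
    (hμb : ∀ s : Set X, Bornology.IsBounded s → μ s < ∞)
    {p : ℝ≥0∞} (hp1 : 1 ≤ p) (hp : p ≠ ∞) (o : X) {u : X → ℝ} (hu : MemLp u p μ) {a : ℝ≥0∞}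
    (ha : a ≠ ∞)
    (h : ∀ R : ℝ, ∀ b > a, ∃ ε > 0, ∃ g : X → ℝ≥0∞, AEMeasurable g μ ∧ IsPairUG ε u g ∧
      eLpNorm g p (μ.restrict (Metric.ball o R)) ≤ b) {θ : ℝ≥0∞} (hθ0 : θ ≠ 0) (hθ : θ ≠ ∞) :
    ∃ v, MemLp v p μ ∧ IsLip v ∧ eLpNorm (v - u) p μ ≤ θ ∧ FChainLip p μ v ≤ a + θ := by
  have := UniformSpace.secondCountable_of_separable X
  have hp0 : p ≠ 0 := (one_pos.trans_le hp1).ne'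
  set τ := θ / 3 with hτ
  have hτ0 : τ ≠ 0 := (ENNReal.div_pos hθ0 (by simp)).ne'
  have hτtop : τ ≠ ∞ := (ENNReal.div_lt_top hθ (by simp)).ne
  have hτ3 : τ + τ + τ = θ := ENNReal.add_thirds θ
  have u_enorm : AEMeasurable (fun x => ‖u x‖ₑ) μ := hu.1.aemeasurable.enorm
  have tail : Tendsto (fun n : ℕ => eLpNorm
      ((Metric.ball o (n + 1))ᶜ.indicator fun x => ‖u x‖ₑ) p μ) atTop (𝓝 0) := by
    have := tendsto_eLpNorm_of_dominated (μ := μ) hp0 hp (f := fun _ => 0)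
      (F := fun (n : ℕ) => (Metric.ball o (n + 1))ᶜ.indicator fun x => ‖u x‖ₑ)
      (W := fun x => ‖u x‖ₑ) (fun n => u_enorm.indicator measurableSet_ball.compl)
      (by rw [eLpNorm_enorm]; exact hu.2.ne) (fun n x => Set.indicator_le_self _ _ _)
      (.of_forall fun x => ?_)
    · rwa [eLpNorm_zero'] at this
    · obtain ⟨N, hN⟩ := exists_nat_gt (dist x o)
      refine tendsto_const_nhds.congr' ?_
      filter_upwards [eventually_ge_atTop N] with n hn
      rw [Set.indicator_of_notMem]
      have : (N : ℝ) ≤ n := by exact_mod_cast hn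
      simp only [Set.mem_compl_iff, Metric.mem_ball, not_not]
      linarith
  have scale : Tendsto (fun n : ℕ => ENNReal.ofReal ((n : ℝ) + 1)⁻¹ * eLpNorm u p μ) atTop
      (𝓝 0) := by
    have h1 : Tendsto (fun n : ℕ => ENNReal.ofReal ((n : ℝ) + 1)⁻¹) atTop (𝓝 0) := by
      have := tendsto_one_div_add_atTop_nhds_zero_nat (𝕜 := ℝ)
      simp only [one_div] at this
      simpa [Function.comp_def] using (ENNReal.continuous_ofReal.tendsto 0).comp this
    simpa using ENNReal.Tendsto.mul_const h1 (Or.inr hu.2.ne)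
  obtain ⟨n, hn1, hn2⟩ := ((tail.eventually_lt_const (pos_iff_ne_zero.2 hτ0)).and
    (scale.eventually_lt_const (pos_iff_ne_zero.2 hτ0))).exists
  set R : ℝ := n + 1
  have hR : 0 < R := by positivity
  obtain ⟨ε, hε, g, hg, hpair, hgn⟩ := h (2 * R + 1) (a + τ) (ENNReal.lt_add_right ha hτ0)
  set B := Metric.ball o (2 * R + 1)
  set g₁ : X → ℝ≥0∞ := B.indicator fun x => g x + ENNReal.ofReal R⁻¹ * ‖u x‖ₑ with hg₁
  have g₁_meas : AEMeasurable g₁ μ := (hg.add (u_enorm.const_mul _)).indicator measurableSet_ball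
  have g₁_norm : eLpNorm g₁ p μ ≤ a + τ + τ := by
    rw [hg₁, eLpNorm_indicator_eq_eLpNorm_restrict measurableSet_ball]
    refine (eLpNorm_add_le hg.restrict.aestronglyMeasurable
      (u_enorm.restrict.const_mul _).aestronglyMeasurable hp1).trans (add_le_add hgn ?_)
    rw [eLpNorm_const_mul_ennreal hp0 hp ENNReal.ofReal_ne_top, eLpNorm_enorm]
    refine le_trans ?_ hn2.le
    gcongr
    exact Measure.restrict_le_self
  have u₁_sub : eLpNorm ((fun x => u x * cutoff o R x) - u) p μ ≤ τ := by
    refine (eLpNorm_mono_enorm fun x => ?_).trans hn1.le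
    rw [enorm_eq_self, Pi.sub_apply]
    by_cases hx : x ∈ Metric.ball o R
    · simp [cutoff_eq_one hR (Metric.mem_ball.1 hx).le]
    · rw [Set.indicator_of_mem (by exact hx), enorm_le_iff_norm_le, Real.norm_eq_abs,
        Real.norm_eq_abs, show u x * cutoff o R x - u x = -(u x * (1 - cutoff o R x)) by ring,
        abs_neg, abs_mul]
      refine mul_le_of_le_one_right (abs_nonneg _) ?_
      rw [abs_of_nonneg (by linarith [cutoff_le_one (o := o) (R := R) x])]
      linarith [cutoff_nonneg (o := o) (R := R) x]
  have u₁_meas : AEStronglyMeasurable (fun x => u x * cutoff o R x) μ :=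
    hu.1.mul (lipschitzWith_cutoff o R).continuous.aestronglyMeasurable
  have u₁_mem : MemLp (fun x => u x * cutoff o R x) p μ := by
    have h1 : MemLp ((fun x => u x * cutoff o R x) - u) p μ :=
      ⟨u₁_meas.sub hu.1, u₁_sub.trans_lt hτtop.lt_top⟩
    simpa using h1.add hu
  obtain ⟨v, hv, hvlip, hvu, hvF⟩ := exists_lipschitz_approx_of_bounded_support hp1 hp
    (o := o) (ρ := 2 * R + 1) (hμb _ Metric.isBounded_ball) u₁_mem
    (fun x hx => by rw [cutoff_eq_zero hR (by linarith), mul_zero]) g₁_meas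
    (ne_top_of_le_ne_top (by finiteness) g₁_norm)
    (fun x hx => Set.indicator_of_notMem (by simpa [B] using hx) _)
    (lt_min hε one_pos) ((hpair.mono (min_le_left ε 1)).mul_cutoff hR (min_le_right ε 1)) hτ0 hτtop
  refine ⟨v, hv, hvlip, ?_, ?_⟩
  · rw [← sub_add_sub_cancel v (fun x => u x * cutoff o R x) u]
    calc _ ≤ _ := eLpNorm_add_le (hv.1.sub u₁_meas) (u₁_meas.sub hu.1) hp1
      _ ≤ τ + τ := add_le_add hvu u₁_sub
      _ ≤ θ := by rw [← hτ3]; exact le_self_add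
  · calc _ ≤ _ := hvF
      _ ≤ a + τ + τ + τ := by gcongr
      _ = a + θ := by rw [← hτ3]; ring

/-! ### Relaxations -/

/-- Relaxations are compared by a diagonal argument: it suffices to approximate functions of finite
energy `F` by functions whose energy `F'` is not much larger. -/
theorem relaxation_le_of_approx {X : Type*} [MeasurableSpace X] {p : ℝ≥0∞} (hp1 : 1 ≤ p)
    {μ : Measure X} {F F' : (X → ℝ) → ℝ≥0∞}
    (h : ∀ v, MemLp v p μ → F v ≠ ∞ → ∀ θ : ℝ≥0∞, θ ≠ 0 → θ ≠ ∞ →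
      ∃ w, MemLp w p μ ∧ eLpNorm (w - v) p μ ≤ θ ∧ F' w ≤ F v + θ) (u : Lp ℝ p μ) :
    relaxation p μ F' u ≤ relaxation p μ F u := by
  refine le_sInf ?_
  rintro _ ⟨v, hv, hvu, rfl⟩
  have hθ : Tendsto (fun j : ℕ => ((j : ℝ≥0∞) + 1)⁻¹) atTop (𝓝 0) := by
    have := ENNReal.tendsto_inv_nat_nhds_zero.comp (tendsto_add_atTop_nat 1)
    simpa [Function.comp_def] using this
  have key : ∀ j : ℕ, ∃ w, MemLp w p μ ∧ eLpNorm (w - v j) p μ ≤ ((j : ℝ≥0∞) + 1)⁻¹ ∧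
      F' w ≤ F (v j) + ((j : ℝ≥0∞) + 1)⁻¹ := fun j => by
    by_cases hF : F (v j) = ∞
    · exact ⟨v j, hv j, by simp, by simp [hF]⟩
    · exact h (v j) (hv j) hF _ (by simp) (by simp)
  choose w hw hwv hwF using key
  have hwu : Tendsto (fun j => eLpNorm (w j - ⇑u) p μ) atTop (𝓝 0) := by
    have hlim := hθ.add hvu
    rw [add_zero] at hlim
    refine tendsto_of_tendsto_of_tendsto_of_le_of_le tendsto_const_nhds hlim (fun _ => zero_le)
      fun j => ?_
    have h1 := eLpNorm_add_le ((hw j).1.sub (hv j).1) ((hv j).1.sub (Lp.memLp u).1) hp1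
    rw [sub_add_sub_cancel] at h1
    exact h1.trans (add_le_add (hwv j) le_rfl)
  calc relaxation p μ F' u ≤ liminf (fun j => F' (w j)) atTop := sInf_le ⟨w, hw, hwu, rfl⟩
    _ ≤ _ := liminf_le_liminf (.of_forall hwF)
    _ = _ := (ENNReal.liminf_add_of_right_tendsto_zero hθ _)

theorem relaxation_mono {X : Type*} [MeasurableSpace X] {p : ℝ≥0∞}
    {μ : Measure X} {F F' : (X → ℝ) → ℝ≥0∞} (h : ∀ v, F' v ≤ F v) (u : Lp ℝ p μ) :
    relaxation p μ F' u ≤ relaxation p μ F u := by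
  refine le_sInf ?_
  rintro _ ⟨v, hv, hvu, rfl⟩
  calc relaxation p μ F' u ≤ liminf (fun j => F' (v j)) atTop := sInf_le ⟨v, hv, hvu, rfl⟩
    _ ≤ _ := liminf_le_liminf (.of_forall fun j => h (v j))

section comparison

variable {X : Type*} [MetricSpace X] [TopologicalSpace.SeparableSpace X] [MeasurableSpace X]
  [BorelSpace X] {μ : Measure X} {p : ℝ≥0∞}

theorem relaxation_FChainLip_le_relaxation_FChain (o : X)
    (hμb : ∀ s : Set X, Bornology.IsBounded s → μ s < ∞) (hp1 : 1 ≤ p) (hp : p ≠ ∞)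
    (u : Lp ℝ p μ) : relaxation p μ (FChainLip p μ) u ≤ relaxation p μ (FChain p μ) u := by
  refine relaxation_le_of_approx hp1 (fun v hv hF θ hθ0 hθ => ?_) u
  suffices h : ∀ R : ℝ, ∀ b > FChain p μ v, ∃ ε > 0, ∃ g : X → ℝ≥0∞, AEMeasurable g μ ∧
      IsPairUG ε v g ∧ eLpNorm g p (μ.restrict (Metric.ball o R)) ≤ b by
    obtain ⟨w, hw, -, hwv, hwF⟩ := exists_lipschitz_approx hμb hp1 hp o hv hF h hθ0 hθ
    exact ⟨w, hw, hwv, hwF⟩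
  intro R b hb
  obtain ⟨ε, hb⟩ := iInf_lt_iff.1 (show FChain p μ v < b from hb)
  obtain ⟨hε, hb⟩ := iInf_lt_iff.1 hb
  obtain ⟨g, hb⟩ := iInf_lt_iff.1 hb
  obtain ⟨hg, hb⟩ := iInf_lt_iff.1 hb
  exact ⟨ε, hε, g, hg.1.aemeasurable, .of_mem_UG hg,
    (eLpNorm_mono_measure _ Measure.restrict_le_self).trans hb.le⟩

/-- For a Lipschitz function, the slopes at small scales are upper gradients, and on balls they
converge to the local Lipschitz constant in `L^p` by dominated convergence. -/
theorem relaxation_FChainLip_le_relaxation_FAGS (o : X)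
    (hμb : ∀ s : Set X, Bornology.IsBounded s → μ s < ∞) (hp1 : 1 ≤ p) (hp : p ≠ ∞)
    (u : Lp ℝ p μ) : relaxation p μ (FChainLip p μ) u ≤ relaxation p μ (FAGS p μ) u := by
  have hp0 : p ≠ 0 := (one_pos.trans_le hp1).ne'
  refine relaxation_le_of_approx hp1 (fun v hv hF θ hθ0 hθ => ?_) u
  suffices h : ∀ R : ℝ, ∀ b > FAGS p μ v, ∃ ε > 0, ∃ g : X → ℝ≥0∞, AEMeasurable g μ ∧
      IsPairUG ε v g ∧ eLpNorm g p (μ.restrict (Metric.ball o R)) ≤ b by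
    obtain ⟨w, hw, -, hwv, hwF⟩ := exists_lipschitz_approx hμb hp1 hp o hv hF h hθ0 hθ
    exact ⟨w, hw, hwv, hwF⟩
  intro R b hb
  by_cases hlip : IsLip v
  swap
  · exact absurd (if_neg hlip) hF
  obtain ⟨K, hK⟩ := id hlip
  rw [FAGS, if_pos hlip] at hb
  set ν := μ.restrict (Metric.ball o R)
  have : IsFiniteMeasure ν := ⟨by simpa [ν] using hμb _ Metric.isBounded_ball⟩
  have hlim : Tendsto (fun n : ℕ => 1 / ((n : ℝ) + 1)) atTop (𝓝[>] 0) :=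
    tendsto_nhdsWithin_iff.2 ⟨tendsto_one_div_add_atTop_nhds_zero_nat,
      .of_forall fun n => Set.mem_Ioi.2 (by positivity)⟩
  have key := tendsto_eLpNorm_of_dominated (μ := ν) hp0 hp
    (F := fun n : ℕ => slope v (1 / ((n : ℝ) + 1))) (W := fun _ => (K : ℝ≥0∞)) (f := lip v)
    (fun n => (measurable_slope hK.continuous _).aemeasurable)
    (by
      have := (memLp_const (μ := ν) (p := p) (K : ℝ)).2.ne
      rw [← eLpNorm_enorm] at this
      simpa using this)
    (fun n x => slope_le hK _ x) (.of_forall fun x => (tendsto_slope v x).comp hlim)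
  obtain ⟨n, hn⟩ := (key.eventually_lt_const
    ((eLpNorm_mono_measure _ Measure.restrict_le_self).trans_lt hb)).exists
  have hn0 : 0 < 1 / ((n : ℝ) + 1) := by positivity
  exact ⟨_, half_pos hn0, _, (measurable_slope hK.continuous _).aemeasurable,
    isPairUG_slope v (half_lt_self hn0), hn.le⟩

end comparison

end ChainSobolev

/-- On a separable, possibly non-complete metric space with a non-trivial Radon measure that is finite
on bounded sets, and for `1 ≤ p < ∞`, the Lipschitz chain Sobolev space, the chain Sobolev space and
the Ambrosio–Gigli–Savaré space coincide, with equal norms. -/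
theorem theorem1p2 {X : Type*} [MetricSpace X] [TopologicalSpace.SeparableSpace X]
    [MeasurableSpace X] [BorelSpace X] (μ : MeasureTheory.Measure X)
    [MeasureTheory.Measure.Regular μ]
    (hμ0 : μ ≠ 0) (hμb : ∀ s : Set X, Bornology.IsBounded s → μ s < ∞)
    (p : ℝ≥0∞) (hp1 : 1 ≤ p) (hp : p ≠ ∞) :
    ChainSobolev.HChainLip p μ = ChainSobolev.HChain p μ ∧
    ChainSobolev.HChain p μ = ChainSobolev.HAGS p μ ∧
    ∀ u : MeasureTheory.Lp ℝ p μ,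
      ChainSobolev.normHChainLip p μ u = ChainSobolev.normHChain p μ u ∧
      ChainSobolev.normHChain p μ u = ChainSobolev.normHAGS p μ u := by
  obtain ⟨o⟩ : Nonempty X := by
    by_contra hX
    rw [not_nonempty_iff] at hX
    exact hμ0 (Measure.eq_zero_of_isEmpty μ)
  have h1 : ChainSobolev.relaxation p μ (ChainSobolev.FChainLip p μ)
      = ChainSobolev.relaxation p μ (ChainSobolev.FChain p μ) := funext fun u =>
    (ChainSobolev.relaxation_FChainLip_le_relaxation_FChain o hμb hp1 hp u).antisymm
      (ChainSobolev.relaxation_mono (ChainSobolev.FChain_le_FChainLip p μ) u)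
  have h2 : ChainSobolev.relaxation p μ (ChainSobolev.FChainLip p μ)
      = ChainSobolev.relaxation p μ (ChainSobolev.FAGS p μ) := funext fun u =>
    (ChainSobolev.relaxation_FChainLip_le_relaxation_FAGS o hμb hp1 hp u).antisymm
      (ChainSobolev.relaxation_mono (ChainSobolev.FAGS_le_FChainLip p μ) u)
  simp only [ChainSobolev.HChainLip, ChainSobolev.HChain, ChainSobolev.HAGS,
    ChainSobolev.normHChainLip, ChainSobolev.normHChain, ChainSobolev.normHAGS,
    ChainSobolev.space, ChainSobolev.spaceNorm, ← h1, ← h2, and_self, implies_true]
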